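/- Let $d\ge 3$ be an integer and let $F\colon[0,\infty)\to\mathbb R$ be $\lfloor d/2\rfloor$ times continuously differentiable on $[0,\infty)$ (with one-sided derivatives at $0$). Assume that $F^{(\lfloor d/2\rfloor)}$ is slowly increasing, i.e. that there are constants $c,k,R>1$ with $|F^{(\lfloor d/2\rfloor)}(r)|\le c\,r^k$ for all $r>R$. Write $(\mathcal R_dF)(x)=F(\|x\|)$ for $x\in\mathbb R^d$. For $n\in\{1,d\}$ let $\mathcal F_n$ be the Fourier transform on tempered distributions on $\mathbb R^n$, $\langle\mathcal F_nT,\varphi\rangle=\langle T,\mathcal F_n\varphi\rangle$, where $\mathcal F_n\varphi(v)=\int_{\mathbb R^n}e^{-2\pi i\langle x,v\rangle}\varphi(x)\,dx$ for Schwartz functions $\varphi$. For a tempered distribution $T$ on $\mathbb R^d$ let $\mathcal R_d^\star T$ be the tempered distribution on $\mathbb R$ given by $$\langle\mathcal R_d^\star T,\psi\rangle=\Big\langle T,\;x\mapsto\tfrac12\big(\psi(\|x\|)+\psi(-\|x\|)\big)\Big\rangle,\qquad \psi\in\mathcal S(\mathbb R).$$ A tempered distribution $T$ on $\mathbb R^n$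 is called regular, and generated by a locally integrable function $g$ on $\mathbb R^n$, if $\langle T,\varphi\rangle=\int_{\mathbb R^n}g(x)\varphi(x)\,dx$ for every $\varphi\in\mathcal S(\mathbb R^n)$, the integrals being absolutely convergent. Then $\mathcal R_dF$ generates a regular tempered distribution on $\mathbb R^d$, and the tempered distribution $$f:=(\mathcal F_1^{-1}\circ\mathcal R_d^\star\circ\mathcal F_d)[\mathcal R_dF]$$ on $\mathbb R$ is regular and generated by a continuous function $f\colon\mathbb R\to\mathbb R$, which satisfies the slicing relation $$F(\|z\|)=\mathbb E_{\xi\sim\mathcal U_{\mathbb S^{d-1}}}\big[f(|\langle z,\xi\rangle|)\big]\qquad\text{for all }z\in\mathbb R^d,$$ where $\mathcal U_{\mathbb S^{d-1}}$ is the uniform distribution on the unit sphere $\mathbb S^{d-1}$ of $\mathbb R^d$. -/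

import Mathlib

open MeasureTheory Set
open scoped SchwartzMap ContDiff FourierTransform RealInnerProductSpace

noncomputable section

namespace Slicing

/-- The averaging operator in dimension one, `ψ ↦ (ψ(r) + ψ(-r)) / 2`, on Schwartz functions. -/
def averageOne : 𝓢(ℝ, ℂ) →L[ℂ] 𝓢(ℝ, ℂ) :=
  (2⁻¹ : ℂ) • (ContinuousLinearMap.id ℂ 𝓢(ℝ, ℂ) +
    SchwartzMap.compCLMOfContinuousLinearEquiv ℂ (ContinuousLinearEquiv.neg ℝ))

theorem averageOne_apply (ψ : 𝓢(ℝ, ℂ)) (r : ℝ) :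
    averageOne ψ r = (ψ r + ψ (-r)) / 2 := by
  simp [averageOne, div_eq_inv_mul, mul_add]

theorem averageOne_even (ψ : 𝓢(ℝ, ℂ)) (r : ℝ) : averageOne ψ (-r) = averageOne ψ r := by
  simp [averageOne_apply, add_comm]

/-- The iterated derivatives of `averageOne ψ`. -/
def derivAvg : ℕ → 𝓢(ℝ, ℂ) →L[ℂ] 𝓢(ℝ, ℂ)
  | 0 => averageOne
  | n + 1 => (SchwartzMap.derivCLM ℂ ℂ).comp (derivAvg n)

theorem hasDerivAt_derivAvg (n : ℕ) (ψ : 𝓢(ℝ, ℂ)) (r : ℝ) :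
    HasDerivAt (derivAvg n ψ) (derivAvg (n + 1) ψ r) r := by
  have : derivAvg (n + 1) ψ r = deriv (derivAvg n ψ) r := by
    simp [derivAvg, SchwartzMap.derivCLM_apply]
  rw [this]
  exact ((derivAvg n ψ).differentiable r).hasDerivAt

theorem derivAvg_one_zero (ψ : 𝓢(ℝ, ℂ)) : derivAvg 1 ψ 0 = 0 := by
  have h1 : HasDerivAt (averageOne ψ) (derivAvg 1 ψ 0) 0 := hasDerivAt_derivAvg 0 ψ 0
  have h1' : HasDerivAt (averageOne ψ) (derivAvg 1 ψ 0) (-0) := by simpa using h1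
  have h2 := h1'.scomp (0 : ℝ) (hasDerivAt_neg (0 : ℝ))
  have h3 : averageOne ψ ∘ Neg.neg = averageOne ψ := by
    funext r; exact averageOne_even ψ r
  rw [h3] at h2
  have := h1.unique h2
  simp at this
  exact self_eq_neg.mp this

/-- For the even function `g = averageOne ψ`, the `n`-th derivative of `r ↦ g'(r) / r`, written as
an integral that is smooth across `r = 0`. -/
def quotDeriv (ψ : 𝓢(ℝ, ℂ)) (n : ℕ) (r : ℝ) : ℂ :=
  ∫ t in (0 : ℝ)..1, ((t : ℂ) ^ n) * derivAvg (n + 2) ψ (t * r)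

theorem norm_le_seminorm (χ : 𝓢(ℝ, ℂ)) (r : ℝ) : ‖χ r‖ ≤ SchwartzMap.seminorm ℂ 0 0 χ := by
  simpa using SchwartzMap.le_seminorm ℂ 0 0 χ r

theorem norm_integrand_le (χ : 𝓢(ℝ, ℂ)) (n : ℕ) {t : ℝ} (ht : t ∈ uIoc (0 : ℝ) 1) (r : ℝ) :
    ‖((t : ℂ) ^ n) * χ (t * r)‖ ≤ SchwartzMap.seminorm ℂ 0 0 χ := by
  rw [uIoc_of_le zero_le_one] at ht
  have : |t| ≤ 1 := by rw [abs_of_pos ht.1]; exact ht.2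
  rw [norm_mul, norm_pow, Complex.norm_real, Real.norm_eq_abs]
  calc |t| ^ n * ‖χ (t * r)‖ ≤ 1 * SchwartzMap.seminorm ℂ 0 0 χ := by
        gcongr
        · exact pow_le_one₀ (abs_nonneg _) this
        · exact norm_le_seminorm χ _
    _ = _ := one_mul _

theorem norm_quotDeriv_le (ψ : 𝓢(ℝ, ℂ)) (n : ℕ) (r : ℝ) :
    ‖quotDeriv ψ n r‖ ≤ SchwartzMap.seminorm ℂ 0 0 (derivAvg (n + 2) ψ) := by
  have := intervalIntegral.norm_integral_le_of_norm_le_const (a := (0 : ℝ)) (b := 1)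
    (fun t ht => norm_integrand_le (derivAvg (n + 2) ψ) n ht r)
  simpa [quotDeriv] using this

theorem hasDerivAt_quotDeriv (ψ : 𝓢(ℝ, ℂ)) (n : ℕ) (r : ℝ) :
    HasDerivAt (quotDeriv ψ n) (quotDeriv ψ (n + 1) r) r := by
  have hc : ∀ (m l : ℕ) (x : ℝ), Continuous (fun t : ℝ => ((t : ℂ) ^ m) * derivAvg l ψ (t * x)) := by
    intro m l x
    have := (derivAvg l ψ).continuous
    fun_prop
  refine (intervalIntegral.hasDerivAt_integral_of_dominated_loc_of_deriv_le
    (F := fun x t => ((t : ℂ) ^ n) * derivAvg (n + 2) ψ (t * x))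
    (F' := fun x t => ((t : ℂ) ^ (n + 1)) * derivAvg (n + 3) ψ (t * x))
    (bound := fun _ => SchwartzMap.seminorm ℂ 0 0 (derivAvg (n + 3) ψ))
    (s := univ) Filter.univ_mem ?_ ?_ ?_ ?_ ?_ ?_).2
  · exact Filter.Eventually.of_forall fun x => (hc _ _ x).aestronglyMeasurable
  · exact (hc _ _ r).intervalIntegrable _ _
  · exact (hc _ _ r).aestronglyMeasurable
  · exact Filter.Eventually.of_forall fun t ht x _ =>
      norm_integrand_le (derivAvg (n + 3) ψ) (n + 1) ht x
  · exact intervalIntegrable_const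
  · refine Filter.Eventually.of_forall fun t _ x _ => ?_
    have h1 : HasDerivAt (fun x : ℝ => t * x) t x := by
      simpa using (hasDerivAt_id x).const_mul t
    have h2 := (hasDerivAt_derivAvg (n + 2) ψ (t * x)).scomp x h1
    have h3 := h2.const_mul ((t : ℂ) ^ n)
    refine h3.congr_deriv ?_
    rw [Complex.real_smul]; ring

theorem iteratedDeriv_quotDeriv (ψ : 𝓢(ℝ, ℂ)) (n : ℕ) :
    iteratedDeriv n (quotDeriv ψ 0) = quotDeriv ψ n := by
  induction n with
  | zero => simp
  | succ n ih =>
    rw [iteratedDeriv_succ, ih]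
    funext r
    exact (hasDerivAt_quotDeriv ψ n r).deriv

theorem mul_quotDeriv_zero (ψ : 𝓢(ℝ, ℂ)) (r : ℝ) :
    (r : ℂ) * quotDeriv ψ 0 r = derivAvg 1 ψ r := by
  have h : ∀ t ∈ uIcc (0 : ℝ) 1, HasDerivAt (fun t : ℝ => derivAvg 1 ψ (t * r))
      ((r : ℂ) * derivAvg 2 ψ (t * r)) t := by
    intro t _
    have h1 : HasDerivAt (fun t : ℝ => t * r) r t := by
      simpa using (hasDerivAt_id t).mul_const r
    simpa [Function.comp_def] using (hasDerivAt_derivAvg 1 ψ (t * r)).scomp t h1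
  have hc : Continuous fun t : ℝ => (r : ℂ) * derivAvg 2 ψ (t * r) := by
    have := (derivAvg 2 ψ).continuous
    fun_prop
  have := intervalIntegral.integral_eq_sub_of_hasDerivAt h (hc.intervalIntegrable _ _)
  rw [intervalIntegral.integral_const_mul] at this
  simpa [quotDeriv, derivAvg_one_zero] using this

theorem mul_quotDeriv_succ (ψ : 𝓢(ℝ, ℂ)) (n : ℕ) (r : ℝ) :
    (r : ℂ) * quotDeriv ψ (n + 1) r = derivAvg (n + 2) ψ r - (n + 1) * quotDeriv ψ n r := by
  have h : ∀ t ∈ uIcc (0 : ℝ) 1, HasDerivAt (fun t : ℝ => ((t : ℂ) ^ (n + 1)) * derivAvg (n + 2) ψ (t * r))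
      ((n + 1) * ((t : ℂ) ^ n * derivAvg (n + 2) ψ (t * r)) +
        (r : ℂ) * ((t : ℂ) ^ (n + 1) * derivAvg (n + 3) ψ (t * r))) t := by
    intro t _
    have h1 : HasDerivAt (fun t : ℝ => t * r) r t := by
      simpa using (hasDerivAt_id t).mul_const r
    have h2 := (hasDerivAt_derivAvg (n + 2) ψ (t * r)).scomp t h1
    have h3 : HasDerivAt (fun t : ℝ => ((t : ℂ) ^ (n + 1))) ((n + 1) * (t : ℂ) ^ n) t := by
      have h4 := (hasDerivAt_pow (n + 1) (t : ℂ)).comp_ofReal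
      simpa using h4
    refine (h3.mul h2).congr_deriv ?_
    simp only [Complex.real_smul, Function.comp_apply]; ring
  have hc : ∀ (m l : ℕ), Continuous (fun t : ℝ => ((t : ℂ) ^ m) * derivAvg l ψ (t * r)) := by
    intro m l
    have := (derivAvg l ψ).continuous
    fun_prop
  have := intervalIntegral.integral_eq_sub_of_hasDerivAt h
    (((hc _ _).const_mul _).add ((hc _ _).const_mul _) |>.intervalIntegrable _ _)
  rw [intervalIntegral.integral_add (((hc _ _).const_mul _).intervalIntegrable _ _)
    (((hc _ _).const_mul _).intervalIntegrable _ _),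
    intervalIntegral.integral_const_mul, intervalIntegral.integral_const_mul] at this
  simp only [quotDeriv]
  rw [eq_sub_iff_add_eq, add_comm, this]
  simp

theorem continuous_seminorm_comp (k n : ℕ) (L : 𝓢(ℝ, ℂ) →L[ℂ] 𝓢(ℝ, ℂ)) :
    Continuous ((SchwartzMap.seminorm ℂ k n : Seminorm ℂ 𝓢(ℝ, ℂ)).comp L.toLinearMap) :=
  ((schwartz_withSeminorms ℂ ℝ ℂ).continuous_seminorm (k, n)).comp L.continuous

theorem quotDeriv_bound (k n : ℕ) : ∃ q : Seminorm ℂ 𝓢(ℝ, ℂ), Continuous q ∧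
    ∀ (ψ : 𝓢(ℝ, ℂ)) (r : ℝ), |r| ^ k * ‖quotDeriv ψ n r‖ ≤ q ψ := by
  induction k generalizing n with
  | zero =>
    exact ⟨_, continuous_seminorm_comp 0 0 (derivAvg (n + 2)), fun ψ r => by
      simpa using norm_quotDeriv_le ψ n r⟩
  | succ k ih =>
    have key : ∀ (ψ : 𝓢(ℝ, ℂ)) (m : ℕ) (r : ℝ), |r| ^ k * ‖derivAvg m ψ r‖ ≤
        (SchwartzMap.seminorm ℂ k 0).comp (derivAvg m).toLinearMap ψ := fun ψ m r => by
      simpa using SchwartzMap.le_seminorm ℂ k 0 (derivAvg m ψ) r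
    have e : ∀ (ψ : 𝓢(ℝ, ℂ)) (m : ℕ) (r : ℝ), |r| ^ (k + 1) * ‖quotDeriv ψ m r‖ =
        |r| ^ k * ‖(r : ℂ) * quotDeriv ψ m r‖ := fun ψ m r => by
      rw [norm_mul, Complex.norm_real, Real.norm_eq_abs]; ring
    cases n with
    | zero =>
      refine ⟨_, continuous_seminorm_comp k 0 (derivAvg 1), fun ψ r => ?_⟩
      rw [e, mul_quotDeriv_zero]
      exact key ψ 1 r
    | succ n =>
      obtain ⟨q, hq, hb⟩ := ih n
      refine ⟨(SchwartzMap.seminorm ℂ k 0).comp (derivAvg (n + 2)).toLinearMap +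
        (n + 1 : NNReal) • q, ?_, fun ψ r => ?_⟩
      · exact (continuous_seminorm_comp k 0 (derivAvg (n + 2))).add (hq.const_smul (n + 1 : NNReal))
      · rw [e, mul_quotDeriv_succ]
        calc |r| ^ k * ‖derivAvg (n + 2) ψ r - (n + 1) * quotDeriv ψ n r‖
            ≤ |r| ^ k * (‖derivAvg (n + 2) ψ r‖ + ‖((n : ℂ) + 1) * quotDeriv ψ n r‖) := by
              gcongr; exact norm_sub_le _ _
          _ = |r| ^ k * ‖derivAvg (n + 2) ψ r‖ + (n + 1) * (|r| ^ k * ‖quotDeriv ψ n r‖) := by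
              have : ‖((n : ℂ) + 1)‖ = n + 1 := by
                exact_mod_cast Complex.norm_natCast (n + 1)
              rw [norm_mul, this]; ring
          _ ≤ _ := by
              refine add_le_add (key ψ _ r) ?_
              change _ ≤ ((n + 1 : NNReal) : ℝ) * q ψ
              push_cast
              gcongr
              exact hb ψ r

theorem exists_schwartz_bound {q : Seminorm ℂ 𝓢(ℝ, ℂ)} (hq : Continuous q) :
    ∃ (s : Finset (ℕ × ℕ)) (C : ℝ), 0 ≤ C ∧
      ∀ ψ : 𝓢(ℝ, ℂ), q ψ ≤ C * s.sup (schwartzSeminormFamily ℂ ℝ ℂ) ψ := by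
  obtain ⟨s, C, -, h⟩ := Seminorm.bound_of_continuous (schwartz_withSeminorms ℂ ℝ ℂ) q hq
  exact ⟨s, C, C.2, fun ψ => h ψ⟩

theorem quotDeriv_add (ψ χ : 𝓢(ℝ, ℂ)) (r : ℝ) :
    quotDeriv (ψ + χ) 0 r = quotDeriv ψ 0 r + quotDeriv χ 0 r := by
  have hc : ∀ (ψ : 𝓢(ℝ, ℂ)), Continuous (fun t : ℝ => ((t : ℂ) ^ 0) * derivAvg (0 + 2) ψ (t * r)) := by
    intro ψ
    have := (derivAvg (0 + 2) ψ).continuous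
    fun_prop
  simp only [quotDeriv]
  rw [← intervalIntegral.integral_add ((hc _).intervalIntegrable _ _) ((hc _).intervalIntegrable _ _)]
  congr 1; funext t
  rw [map_add, add_apply, mul_add]

theorem quotDeriv_smul (a : ℂ) (ψ : 𝓢(ℝ, ℂ)) (r : ℝ) :
    quotDeriv (a • ψ) 0 r = a • quotDeriv ψ 0 r := by
  simp only [quotDeriv]
  rw [← intervalIntegral.integral_smul]
  congr 1; funext t
  rw [map_smul, smul_apply, smul_eq_mul, smul_eq_mul]; ring

theorem contDiff_quotDeriv (ψ : 𝓢(ℝ, ℂ)) : ContDiff ℝ ∞ (quotDeriv ψ 0) :=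
  contDiff_of_differentiable_iteratedDeriv fun m _ => by
    rw [iteratedDeriv_quotDeriv]
    exact fun r => (hasDerivAt_quotDeriv ψ m r).differentiableAt

/-- `ψ ↦ (r ↦ g'(r) / r)` with `g = averageOne ψ`, as an operator on Schwartz functions. -/
def derivQuot : 𝓢(ℝ, ℂ) →L[ℂ] 𝓢(ℝ, ℂ) :=
  SchwartzMap.mkCLM (fun ψ r => quotDeriv ψ 0 r) quotDeriv_add quotDeriv_smul contDiff_quotDeriv <| by
    rintro ⟨k, n⟩
    obtain ⟨q, hq, hb⟩ := quotDeriv_bound k n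
    obtain ⟨s, C, hC, h⟩ := exists_schwartz_bound hq
    refine ⟨s, C, hC, fun ψ r => ?_⟩
    rw [norm_iteratedFDeriv_eq_norm_iteratedDeriv, iteratedDeriv_quotDeriv]
    exact (hb ψ r).trans (h ψ)

theorem derivAvg_one_odd (ψ : 𝓢(ℝ, ℂ)) (r : ℝ) : derivAvg 1 ψ (-r) = - derivAvg 1 ψ r := by
  have h1 : HasDerivAt (averageOne ψ) (derivAvg 1 ψ (-r)) (-r) := hasDerivAt_derivAvg 0 ψ (-r)
  have h2 := h1.scomp r (hasDerivAt_neg r)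
  have h3 : averageOne ψ ∘ Neg.neg = averageOne ψ := by
    funext r; exact averageOne_even ψ r
  rw [h3] at h2
  have := h2.unique (hasDerivAt_derivAvg 0 ψ r)
  rw [← this]; simp

theorem derivAvg_two_even (ψ : 𝓢(ℝ, ℂ)) (r : ℝ) : derivAvg 2 ψ (-r) = derivAvg 2 ψ r := by
  have h2 := (hasDerivAt_derivAvg 1 ψ (-r)).scomp r (hasDerivAt_neg r)
  have h3 : derivAvg 1 ψ ∘ Neg.neg = -derivAvg 1 ψ := by
    funext r; exact derivAvg_one_odd ψ r
  rw [h3] at h2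
  have := h2.unique (hasDerivAt_derivAvg 1 ψ r).neg
  simpa using this

theorem averageOne_derivQuot (ψ : 𝓢(ℝ, ℂ)) : averageOne (derivQuot ψ) = derivQuot ψ := by
  have : ∀ r, derivQuot ψ (-r) = derivQuot ψ r := fun r => by
    change quotDeriv ψ 0 (-r) = quotDeriv ψ 0 r
    simp [quotDeriv, derivAvg_two_even]
  ext r
  rw [averageOne_apply, this]; ring

section Rotation

variable {E : Type*} [NormedAddCommGroup E] [InnerProductSpace ℝ E]

variable (E) in
/-- `x ↦ ⟪x, ·⟫`, with values regarded as complex numbers. -/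
def innerC : E →L[ℝ] (E →L[ℝ] ℂ) :=
  (ContinuousLinearMap.compL ℝ E ℝ ℂ Complex.ofRealCLM).comp (innerSL ℝ)

theorem innerC_apply (x y : E) : innerC E x y = ((inner ℝ x y : ℝ) : ℂ) := rfl

/-- The function `x ↦ g(‖x‖)` with `g = averageOne ψ`. -/
def rotateFun (ψ : 𝓢(ℝ, ℂ)) (x : E) : ℂ := averageOne ψ ‖x‖

theorem hasFDerivAt_rotateFun (ψ : 𝓢(ℝ, ℂ)) (x : E) :
    HasFDerivAt (rotateFun ψ) (rotateFun (derivQuot ψ) x • innerC E x) x := by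
  have hW : rotateFun (derivQuot ψ) x = quotDeriv ψ 0 ‖x‖ := by
    rw [rotateFun, averageOne_derivQuot]; rfl
  by_cases hx : x = 0
  · subst hx
    have h1 : HasDerivAt (averageOne ψ) 0 0 := by
      have := hasDerivAt_derivAvg 0 ψ 0
      rwa [derivAvg_one_zero] at this
    have h0 : rotateFun (derivQuot ψ) (0 : E) • innerC E 0 = 0 := by ext y; simp
    rw [h0, hasFDerivAt_iff_isLittleO_nhds_zero]
    rw [hasDerivAt_iff_isLittleO_nhds_zero] at h1
    have h2 := h1.comp_tendsto (tendsto_norm_zero (E := E))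
    simpa [rotateFun, Function.comp_def] using h2.of_norm_right
  · have hn : ‖x‖ ≠ 0 := norm_ne_zero_iff.mpr hx
    have h1 : HasDerivAt (averageOne ψ) (derivAvg 1 ψ ‖x‖) ‖x‖ := hasDerivAt_derivAvg 0 ψ ‖x‖
    have h2 : HasFDerivAt (fun y : E => ‖y‖) (‖x‖⁻¹ • innerSL ℝ x) x := by
      have h3 := (hasStrictFDerivAt_norm_sq x).hasFDerivAt
      have h4 := h3.sqrt (by positivity)
      simp only [Real.sqrt_sq (norm_nonneg _)] at h4
      convert h4 using 1
      ext y
      simp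
      field_simp
    have h5 := h1.hasFDerivAt.comp x h2
    refine h5.congr_fderiv ?_
    ext y
    rw [← mul_quotDeriv_zero, ← hW]
    have hn' : (‖x‖ : ℂ) ≠ 0 := by exact_mod_cast hn
    simp [innerC_apply]
    field_simp

theorem fderiv_rotateFun (ψ : 𝓢(ℝ, ℂ)) :
    fderiv ℝ (rotateFun ψ : E → ℂ) = fun x => rotateFun (derivQuot ψ) x • innerC E x :=
  funext fun x => (hasFDerivAt_rotateFun ψ x).fderiv

theorem contDiff_rotateFun (ψ : 𝓢(ℝ, ℂ)) : ContDiff ℝ ∞ (rotateFun ψ : E → ℂ) := by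
  rw [contDiff_infty]
  intro n
  induction n generalizing ψ with
  | zero =>
    exact contDiff_zero.mpr ((averageOne ψ).continuous.comp continuous_norm)
  | succ n ih =>
    refine (contDiff_succ_iff_fderiv (n := (n : ℕ∞ω))).mpr
      ⟨fun x => (hasFDerivAt_rotateFun ψ x).differentiableAt, by simp, ?_⟩
    rw [fderiv_rotateFun]
    exact (ih (derivQuot ψ)).smul (innerC E).contDiff

theorem rotateFun_bound (n k : ℕ) : ∃ q : Seminorm ℂ 𝓢(ℝ, ℂ), Continuous q ∧
    ∀ (ψ : 𝓢(ℝ, ℂ)) (x : E), ‖x‖ ^ k * ‖iteratedFDeriv ℝ n (rotateFun ψ) x‖ ≤ q ψ := by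
  induction n using Nat.strong_induction_on generalizing k with
  | _ n ih =>
    cases n with
    | zero =>
      refine ⟨_, continuous_seminorm_comp k 0 averageOne, fun ψ x => ?_⟩
      simpa [rotateFun] using SchwartzMap.le_seminorm ℂ k 0 (averageOne ψ) ‖x‖
    | succ n =>
      choose! q hq hb using ih
      obtain ⟨l, C, hC, hg⟩ :=
        (innerC E).hasTemperateGrowth.norm_iteratedFDeriv_le_uniform n
      let C' : NNReal := ⟨C * 2 ^ l, by positivity⟩
      let Q : Seminorm ℂ 𝓢(ℝ, ℂ) := ∑ i ∈ Finset.range (n + 1),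
        ((n.choose i : NNReal) * C') • (q i k + q i (k + l))
      have hQa : ∀ χ, Q χ = ∑ i ∈ Finset.range (n + 1),
          ((n.choose i : ℝ) * (C * 2 ^ l)) * (q i k χ + q i (k + l) χ) := by
        intro χ
        rw [← FunLike.coeAddMonoidHom_apply, map_sum, Finset.sum_apply]
        rfl
      have hQc : Continuous Q := by
        have : (Q : 𝓢(ℝ, ℂ) → ℝ) = fun χ => ∑ i ∈ Finset.range (n + 1),
          ((n.choose i : ℝ) * (C * 2 ^ l)) * (q i k χ + q i (k + l) χ) := funext hQa
        rw [this]
        refine continuous_finsetSum _ fun i hi => ?_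
        have hi' : i < n + 1 := Finset.mem_range.mp hi
        exact ((hq i hi' k).add (hq i hi' (k + l))).const_mul _
      refine ⟨Q.comp derivQuot.toLinearMap, hQc.comp derivQuot.continuous, fun ψ x => ?_⟩
      rw [← norm_iteratedFDeriv_fderiv, fderiv_rotateFun]
      change _ ≤ Q (derivQuot ψ)
      rw [hQa]
      have hsm := norm_iteratedFDeriv_smul_le (𝕜 := ℝ) (contDiff_rotateFun (derivQuot ψ))
        (innerC E).contDiff x (n := n) (mod_cast le_top)
      refine (mul_le_mul_of_nonneg_left hsm (by positivity)).trans ?_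
      rw [Finset.mul_sum]
      calc
        _ = ∑ i ∈ Finset.range (n + 1), (n.choose i : ℝ) *
            (‖x‖ ^ k * ‖iteratedFDeriv ℝ i (rotateFun (derivQuot ψ)) x‖) *
            ‖iteratedFDeriv ℝ (n - i) (innerC E) x‖ :=
          Finset.sum_congr rfl fun i _ => by ring
        _ ≤ _ := by
          refine Finset.sum_le_sum fun i hi => ?_
          have hi' : i < n + 1 := Finset.mem_range.mp hi
          have hp : (1 + ‖x‖) ^ l ≤ 2 ^ l * (1 + ‖x‖ ^ l) := by
            rcases le_total ‖x‖ 1 with h | h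
            · calc (1 + ‖x‖) ^ l ≤ (2 : ℝ) ^ l := by gcongr; linarith
                _ ≤ 2 ^ l * (1 + ‖x‖ ^ l) := le_mul_of_one_le_right (by positivity)
                    (by have : 0 ≤ ‖x‖ ^ l := by positivity
                        linarith)
            · calc (1 + ‖x‖) ^ l ≤ (2 * ‖x‖) ^ l := by gcongr; linarith
                _ = 2 ^ l * ‖x‖ ^ l := by rw [mul_pow]
                _ ≤ _ := by gcongr; linarith
          set A := ‖iteratedFDeriv ℝ i (rotateFun (derivQuot ψ)) x‖ with hA
          have h1 := hb i hi' k (derivQuot ψ) x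
          have h2 := hb i hi' (k + l) (derivQuot ψ) x
          calc (n.choose i : ℝ) * (‖x‖ ^ k * A) * ‖iteratedFDeriv ℝ (n - i) (innerC E) x‖
              ≤ (n.choose i : ℝ) * (‖x‖ ^ k * A) * (C * (2 ^ l * (1 + ‖x‖ ^ l))) := by
                gcongr
                exact (hg (n - i) (Nat.sub_le _ _) x).trans (by gcongr)
            _ = (n.choose i : ℝ) * (C * 2 ^ l) * (‖x‖ ^ k * A + ‖x‖ ^ (k + l) * A) := by ring
            _ ≤ _ := by gcongr

/-- The rotation operator: the radial function on `E` with profile `F`. Only the values of `F` on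
`[0, ∞)` matter. -/
def rotation {β : Type*} (F : ℝ → β) (x : E) : β := F ‖x‖

variable (E) in
/-- The rotation operator after one-dimensional averaging, `ψ ↦ (x ↦ (averageOne ψ)(‖x‖))`, as a
continuous linear map from the Schwartz functions on `ℝ` to those on `E`. -/
def rotateAvg : 𝓢(ℝ, ℂ) →L[ℂ] 𝓢(E, ℂ) :=
  SchwartzMap.mkCLM (fun ψ x => rotateFun ψ x)
    (fun ψ χ x => by simp [rotateFun]) (fun a ψ x => by simp [rotateFun])
    contDiff_rotateFun <| by
    rintro ⟨k, n⟩
    obtain ⟨q, hq, hb⟩ := rotateFun_bound (E := E) n k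
    obtain ⟨s, C, hC, h⟩ := exists_schwartz_bound hq
    exact ⟨s, C, hC, fun ψ x => (hb ψ x).trans (h ψ)⟩

theorem coe_rotateAvg (ψ : 𝓢(ℝ, ℂ)) : ⇑(rotateAvg E ψ) = rotation (averageOne ψ) := rfl

theorem rotateAvg_apply (ψ : 𝓢(ℝ, ℂ)) (x : E) :
    rotateAvg E ψ x = (ψ ‖x‖ + ψ (-‖x‖)) / 2 := averageOne_apply ψ ‖x‖

variable (E) in
/-- The adjoint rotation operator on tempered distributions,
`⟨rotationStar E T, ψ⟩ = ⟨T, x ↦ (averageOne ψ)(‖x‖)⟩`. -/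
def rotationStar : 𝓢'(E, ℂ) →L[ℂ] 𝓢'(ℝ, ℂ) :=
  PointwiseConvergenceCLM.precomp ℂ (rotateAvg E)

theorem rotationStar_apply (T : 𝓢'(E, ℂ)) (ψ : 𝓢(ℝ, ℂ)) :
    rotationStar E T ψ = T (rotateAvg E ψ) := rfl

/-- The tempered distribution `T` is regular and generated by the locally integrable function `g`:
`⟨T, φ⟩ = ∫ g φ` for all Schwartz functions `φ`, the integrals being convergent. -/
def IsGeneratedBy [MeasureSpace E] (T : 𝓢'(E, ℂ)) (g : E → ℂ) : Prop :=
  LocallyIntegrable g volume ∧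
    ∀ φ : 𝓢(E, ℂ), Integrable (fun x => g x * φ x) volume ∧ T φ = ∫ x, g x * φ x

end Rotation

/-- A function on `[0, ∞)` is slowly increasing if it is locally integrable there and bounded by a
power outside a bounded set. -/
def SlowlyIncreasing (T : ℝ → ℝ) : Prop :=
  LocallyIntegrableOn T (Ici 0) volume ∧
    ∃ c k R : ℝ, 1 < c ∧ 1 < k ∧ 1 < R ∧ ∀ x : ℝ, R < x → |T x| ≤ c * x ^ k

/-- The uniform probability distribution on the unit sphere of `ℝ^d`: the normalized surface
measure. -/
def uniformSphere (d : ℕ) : Measure (Metric.sphere (0 : EuclideanSpace ℝ (Fin d)) 1) :=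
  ((volume : Measure (EuclideanSpace ℝ (Fin d))).toSphere univ)⁻¹ •
    (volume : Measure (EuclideanSpace ℝ (Fin d))).toSphere

end Slicing

end

noncomputable section

namespace Slicing

/-! Averaging `f |⟪z, ξ⟫|` over the sphere multiplies the monomial `t ^ n` by the moment `M n =
Γ(d/2) Γ((n+1)/2) / (Γ(1/2) Γ((n+d)/2))`. Inverting the slicing relation thus means realising the
multiplier `1 / M n`. With `m = d / 2` (floor), `Γ((n+1)/2 + m) / Γ((n+1)/2)` is a polynomial of
degree `m` in `n`, hence the symbol of an Euler operator `∑ aₖ xᵏ ∂ᵏ` of order `m`; this is where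
`m` derivatives of `F` are consumed. For odd `d` this is `1 / M n` up to a constant. For even `d` a
quotient of Gamma values half a step apart remains, and it is a moment sequence of a probability
measure on `[0, 1]` (`exists_measure_coeff_mul_moment_eq_one`). So `f` is a multiplicative average
of the Euler operator applied to `F`. It is continuous, even and of polynomial growth. The slicing
relation holds on polynomials by the moment identity, and for `F` by polynomial approximation
together with derivatives (`integral_eulerOp_eq`).

That `f` generates the back-transformed distribution follows from the slicing relation: it writes
the radial function as a mean of ridge functions `f ⟪ξ, x⟫`. Against the Fourier transform of a
radial Schwartz function each ridge function sees only the restriction of that radial function to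
the line `ℝ ξ`, so the pairing collapses to the one-dimensional `∫ f ψ`
(`integral_ridge_mul_fourier_rotateAvg`), independently of `ξ`. -/

/-! ### Moments of a coordinate on the sphere. -/

theorem integral_pow_mul_exp_neg_sq (q : ℕ) :
    ∫ r in Ioi (0 : ℝ), r ^ q * Real.exp (-r ^ 2) = Real.Gamma ((q + 1) / 2) / 2 := by
  have h := integral_rpow_mul_exp_neg_rpow (p := 2) (q := q) two_pos
    (by have : (0 : ℝ) ≤ q := q.cast_nonneg
        linarith)
  simp only [Real.rpow_natCast, Real.rpow_ofNat] at h
  rw [h]; ring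

theorem integral_abs_pow_mul_exp_neg_sq (q : ℕ) :
    ∫ t : ℝ, |t| ^ q * Real.exp (-t ^ 2) = Real.Gamma ((q + 1) / 2) := by
  have h := integral_comp_abs (f := fun t : ℝ => t ^ q * Real.exp (-t ^ 2))
  simp only [sq_abs] at h
  rw [h, integral_pow_mul_exp_neg_sq]; ring

/-- In an orthonormal basis containing `z` the Gaussian factorises: one coordinate carries the power
`q`, the other `d - 1` contribute `Γ(1/2) = √π` each. -/
theorem integral_abs_inner_pow_mul_gaussian {d : ℕ} {z : EuclideanSpace ℝ (Fin d)} (hz : ‖z‖ = 1)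
    (q : ℕ) :
    ∫ x : EuclideanSpace ℝ (Fin d), |⟪z, x⟫| ^ q * Real.exp (-‖x‖ ^ 2) =
      Real.Gamma ((q + 1) / 2) * Real.Gamma (1 / 2) ^ (d - 1) := by
  obtain ⟨i₀⟩ : Nonempty (Fin d) := by
    by_contra h
    rw [not_nonempty_iff] at h
    simp [Subsingleton.elim z 0] at hz
  obtain ⟨b, hb⟩ := Orthonormal.exists_orthonormalBasis_extension_of_card_eq (𝕜 := ℝ)
    (E := EuclideanSpace ℝ (Fin d)) (ι := Fin d) (by simp) (v := fun _ => z) (s := {i₀})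
    ⟨fun i => by simpa using hz, fun i j hij => (hij (Subsingleton.elim i j)).elim⟩
  have hb0 : b i₀ = z := hb i₀ rfl
  rw [← b.measurePreserving_repr_symm.integral_comp
    b.repr.symm.toHomeomorph.measurableEmbedding,
    ← (PiLp.volume_preserving_toLp (Fin d)).integral_comp
    (MeasurableEquiv.toLp 2 (Fin d → ℝ)).measurableEmbedding]
  have e : ∀ y : Fin d → ℝ, |⟪z, b.repr.symm (WithLp.toLp 2 y)⟫| ^ q *
      Real.exp (-‖b.repr.symm (WithLp.toLp 2 y)‖ ^ 2) =
      ∏ i, (if i = i₀ then |y i| ^ q else 1) * Real.exp (-y i ^ 2) := by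
    intro y
    rw [← hb0, ← b.repr_apply_apply, LinearIsometryEquiv.apply_symm_apply,
      LinearIsometryEquiv.norm_map, EuclideanSpace.norm_sq_eq, Finset.prod_mul_distrib,
      ← Real.exp_sum]
    simp
  simp only [e]
  rw [integral_fintype_prod_volume_eq_prod (fun i (t : ℝ) =>
    (if i = i₀ then |t| ^ q else 1) * Real.exp (-t ^ 2))]
  rw [← Finset.mul_prod_erase _ _ (Finset.mem_univ i₀)]
  congr 1
  · simpa using integral_abs_pow_mul_exp_neg_sq q
  · rw [Finset.prod_congr rfl (g := fun _ => Real.Gamma (1 / 2))]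
    · simp
    · intro i hi
      simpa [Finset.ne_of_mem_erase hi] using integral_abs_pow_mul_exp_neg_sq 0

/-- The same Gaussian integral in polar coordinates; the radial part `r ^ (q + d - 1) e^{-r²}` gives
the Gamma factor. Comparing the two evaluations yields the spherical moments. -/
theorem integral_abs_inner_pow_mul_gaussian_eq_polar {d : ℕ} (hd : 1 ≤ d)
    (z : EuclideanSpace ℝ (Fin d)) (q : ℕ) :
    ∫ x : EuclideanSpace ℝ (Fin d), |⟪z, x⟫| ^ q * Real.exp (-‖x‖ ^ 2) =
      (∫ ξ, |⟪z, (ξ : EuclideanSpace ℝ (Fin d))⟫| ^ q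
        ∂(volume : Measure (EuclideanSpace ℝ (Fin d))).toSphere) *
      (Real.Gamma ((q + d) / 2) / 2) := by
  have : NeZero d := ⟨by omega⟩
  set μ : Measure (EuclideanSpace ℝ (Fin d)) := volume
  have key : ∀ p : Metric.sphere (0 : EuclideanSpace ℝ (Fin d)) 1 × Ioi (0 : ℝ),
      |⟪z, (p.2 : ℝ) • (p.1 : EuclideanSpace ℝ (Fin d))⟫| ^ q *
        Real.exp (-‖(p.2 : ℝ) • (p.1 : EuclideanSpace ℝ (Fin d))‖ ^ 2) =
      |⟪z, (p.1 : EuclideanSpace ℝ (Fin d))⟫| ^ q * ((p.2 : ℝ) ^ q * Real.exp (-(p.2 : ℝ) ^ 2)) := by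
    rintro ⟨ξ, r, hr⟩
    have hr' : 0 < r := hr
    simp [inner_smul_right, norm_smul, abs_mul, abs_of_pos hr', mul_pow]
    ring
  calc
    _ = ∫ x : ({(0)}ᶜ : Set (EuclideanSpace ℝ (Fin d))), |⟪z, (x : EuclideanSpace ℝ (Fin d))⟫| ^ q *
          Real.exp (-‖(x : EuclideanSpace ℝ (Fin d))‖ ^ 2) ∂(μ.comap (↑)) := by
        rw [integral_subtype_comap (measurableSet_singleton _).compl
          fun x : EuclideanSpace ℝ (Fin d) => |⟪z, x⟫| ^ q * Real.exp (-‖x‖ ^ 2),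
          restrict_compl_singleton]
    _ = ∫ p, |⟪z, (p.1 : EuclideanSpace ℝ (Fin d))⟫| ^ q *
          ((p.2 : ℝ) ^ q * Real.exp (-(p.2 : ℝ) ^ 2))
          ∂(μ.toSphere.prod (Measure.volumeIoiPow (Module.finrank ℝ (EuclideanSpace ℝ (Fin d)) - 1))) := by
        rw [← μ.measurePreserving_homeomorphUnitSphereProd.integral_comp
          (Homeomorph.measurableEmbedding _)]
        refine integral_congr_ae (Filter.Eventually.of_forall fun x => ?_)
        simp only
        rw [← key]
        have hx : ‖(x : EuclideanSpace ℝ (Fin d))‖ ≠ 0 := norm_ne_zero_iff.mpr x.2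
        simp [smul_smul, hx]
    _ = (∫ ξ, |⟪z, (ξ : EuclideanSpace ℝ (Fin d))⟫| ^ q ∂μ.toSphere) *
          ∫ r : Ioi (0 : ℝ), (r : ℝ) ^ q * Real.exp (-(r : ℝ) ^ 2) ∂(Measure.volumeIoiPow (d - 1)) := by
        rw [finrank_euclideanSpace_fin]
        exact integral_prod_mul (fun ξ : Metric.sphere (0 : EuclideanSpace ℝ (Fin d)) 1 =>
          |⟪z, (ξ : EuclideanSpace ℝ (Fin d))⟫| ^ q)
          (fun r : Ioi (0 : ℝ) => (r : ℝ) ^ q * Real.exp (-(r : ℝ) ^ 2))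
    _ = _ := by
        congr 1
        rw [Measure.volumeIoiPow, integral_withDensity_eq_integral_toReal_smul
          (by fun_prop) (by simp)]
        have := integral_subtype_comap (μ := volume) (measurableSet_Ioi (a := (0 : ℝ)))
          (fun r : ℝ => (ENNReal.ofReal (r ^ (d - 1))).toReal • (r ^ q * Real.exp (-r ^ 2)))
        rw [this]
        have h2 := integral_pow_mul_exp_neg_sq (d - 1 + q)
        have h3 : (((d - 1 + q : ℕ) : ℝ) + 1) = q + d := by
          rw [Nat.cast_add, Nat.cast_sub hd]; push_cast; ring
        rw [h3] at h2
        rw [← h2]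
        refine setIntegral_congr_fun measurableSet_Ioi fun r hr => ?_
        have hr' : (0 : ℝ) < r := hr
        rw [ENNReal.toReal_ofReal (by positivity), smul_eq_mul, pow_add]; ring

theorem uniformSphere_isProbabilityMeasure {d : ℕ} (hd : 1 ≤ d) :
    IsProbabilityMeasure (uniformSphere d) := by
  have : NeZero d := ⟨by omega⟩
  refine ⟨?_⟩
  rw [uniformSphere, Measure.smul_apply, smul_eq_mul]
  refine ENNReal.inv_mul_cancel ?_ (measure_ne_top _ _)
  simp only [ne_eq, Measure.measure_univ_eq_zero]
  exact Measure.toSphere_ne_zero _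

/-- The moments of `|⟪z, ξ⟫|` for `ξ` uniformly distributed on the unit sphere. -/
theorem integral_abs_inner_pow_uniformSphere {d : ℕ} (hd : 1 ≤ d) {z : EuclideanSpace ℝ (Fin d)}
    (hz : ‖z‖ = 1) (q : ℕ) :
    ∫ ξ, |⟪z, (ξ : EuclideanSpace ℝ (Fin d))⟫| ^ q ∂(uniformSphere d) =
      Real.Gamma (d / 2) * Real.Gamma ((q + 1) / 2) /
        (Real.Gamma (1 / 2) * Real.Gamma ((q + d) / 2)) := by
  have := uniformSphere_isProbabilityMeasure hd
  -- The constant `c` collects the surface area and the powers of `Γ(1/2)`. It does not depend on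
  -- `q`, so the case `q = 0`, total mass one, determines it.
  obtain ⟨c, hc⟩ : ∃ c : ℝ, ∀ q : ℕ,
      (∫ ξ, |⟪z, (ξ : EuclideanSpace ℝ (Fin d))⟫| ^ q ∂(uniformSphere d)) *
        Real.Gamma ((q + d) / 2) = c * Real.Gamma ((q + 1) / 2) := by
    set v := ((volume : Measure (EuclideanSpace ℝ (Fin d))).toSphere univ)⁻¹.toReal with hv
    refine ⟨v * (2 * Real.Gamma (1 / 2) ^ (d - 1)), fun q => ?_⟩
    have h1 := integral_abs_inner_pow_mul_gaussian hz q
    rw [integral_abs_inner_pow_mul_gaussian_eq_polar hd] at h1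
    rw [uniformSphere, integral_smul_measure, smul_eq_mul, ← hv]
    linear_combination 2 * v * h1
  have h0 := hc 0
  have hq := hc q
  have p1 : 0 < Real.Gamma (1 / 2) := Real.Gamma_pos_of_pos (by norm_num)
  have p2 : 0 < Real.Gamma ((q + d) / 2) := Real.Gamma_pos_of_pos (by positivity)
  simp at h0
  rw [eq_div_iff (by positivity)]
  simp only [one_div] at *
  linear_combination Real.Gamma (2⁻¹) * hq - Real.Gamma ((q + 1) / 2) * h0

/-! ### Reciprocal moments: beta distributions and Euler symbols. -/

theorem integral_betaPDFReal {α β : ℝ} (hα : 0 < α) (hβ : 0 < β) :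
    ∫ x, ProbabilityTheory.betaPDFReal α β x = 1 := by
  have h := ProbabilityTheory.lintegral_betaPDF_eq_one hα hβ
  rw [integral_eq_lintegral_of_nonneg_ae]
  · change (∫⁻ x, ProbabilityTheory.betaPDF α β x).toReal = 1
    rw [h]; rfl
  · refine Filter.Eventually.of_forall fun x => ?_
    by_cases hx : 0 < x ∧ x < 1
    · exact (ProbabilityTheory.betaPDFReal_pos hx.1 hx.2 hα hβ).le
    · simp [ProbabilityTheory.betaPDFReal, hx]
  · exact (ProbabilityTheory.measurable_betaPDFReal α β).aestronglyMeasurable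

/-- Multiplying the beta density by `u ^ (n / 2)` only shifts its first parameter, so the integral
is a ratio of normalising constants. -/
theorem integral_sqrt_pow_betaMeasure {α β : ℝ} (hα : 0 < α) (hβ : 0 < β) (n : ℕ) :
    ∫ u, √u ^ n ∂(ProbabilityTheory.betaMeasure α β) =
      ProbabilityTheory.beta (α + n / 2) β / ProbabilityTheory.beta α β := by
  have hα' : 0 < α + n / 2 := by positivity
  have b1 := ProbabilityTheory.beta_pos hα hβ
  have b2 := ProbabilityTheory.beta_pos hα' hβ
  rw [ProbabilityTheory.betaMeasure, integral_withDensity_eq_integral_toReal_smul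
    (show Measurable (ProbabilityTheory.betaPDF α β) from
      (ProbabilityTheory.measurable_betaPDFReal α β).ennreal_ofReal)
    (by simp [ProbabilityTheory.betaPDF])]
  have e : ∀ u : ℝ, (ProbabilityTheory.betaPDF α β u).toReal • √u ^ n =
      ProbabilityTheory.beta (α + n / 2) β / ProbabilityTheory.beta α β *
        ProbabilityTheory.betaPDFReal (α + n / 2) β u := by
    intro u
    by_cases hu : 0 < u ∧ u < 1
    · rw [ProbabilityTheory.betaPDF, ENNReal.toReal_ofReal
        (ProbabilityTheory.betaPDFReal_pos hu.1 hu.2 hα hβ).le]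
      simp only [ProbabilityTheory.betaPDFReal, hu, and_self, if_true, smul_eq_mul]
      have h1 : √u ^ n = u ^ ((n : ℝ) / 2) := by
        rw [Real.sqrt_eq_rpow, ← Real.rpow_natCast, ← Real.rpow_mul hu.1.le]
        congr 1; ring
      have h2 : u ^ (α + n / 2 - 1) = u ^ (α - 1) * u ^ ((n : ℝ) / 2) := by
        rw [← Real.rpow_add hu.1]; congr 1; ring
      rw [h1, h2]
      generalize ProbabilityTheory.beta (α + n / 2) β = B at b2 ⊢
      field_simp
    · simp [ProbabilityTheory.betaPDF, ProbabilityTheory.betaPDFReal, hu]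
  simp only [e]
  rw [integral_const_mul, integral_betaPDFReal hα' hβ, mul_one]

/-- The quotient is the rising factorial `s (s + 1) ⋯ (s + m - 1)` at `s = (n + 1) / 2`. Descending
factorials are the right basis because `xᵏ ∂ᵏ` multiplies `xⁿ` by `n.descFactorial k`. -/
theorem exists_sum_descFactorial_eq_Gamma_div (m : ℕ) : ∃ a : ℕ → ℝ, (∀ k, m < k → a k = 0) ∧
    ∀ n : ℕ, ∑ k ∈ Finset.range (m + 1), a k * n.descFactorial k =
      Real.Gamma ((n + 1) / 2 + m) / Real.Gamma ((n + 1) / 2) := by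
  induction m with
  | zero =>
    refine ⟨fun k => if k = 0 then 1 else 0, fun k hk => by simp [hk.ne'], fun n => ?_⟩
    have : Real.Gamma (((n : ℝ) + 1) / 2) ≠ 0 := (Real.Gamma_pos_of_pos (by positivity)).ne'
    simp [this]
  | succ m ih =>
    obtain ⟨a, ha0, ha⟩ := ih
    -- The new factor is `(n + 1) / 2 + m = (k / 2 + 1 / 2 + m) + (n - k) / 2`, and `n - k` raises
    -- the `k`-th descending factorial to the next one.
    refine ⟨fun k => a k * (k / 2 + 1 / 2 + m) + (if k = 0 then 0 else a (k - 1) / 2),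
      fun k hk => ?_, fun n => ?_⟩
    · simp [ha0 k (by omega), ha0 (k - 1) (by omega)]
    · have e : ((n : ℝ) + 1) / 2 + (m + 1 : ℕ) = ((n + 1) / 2 + m) + 1 := by push_cast; ring
      rw [e, Real.Gamma_add_one (by positivity), mul_div_assoc, ← ha n]
      simp only [add_mul, Finset.sum_add_distrib]
      rw [Finset.sum_range_succ, ha0 (m + 1) (by omega), Finset.sum_range_succ' (fun k =>
        (if k = 0 then 0 else a (k - 1) / 2) * (n.descFactorial k : ℝ))]
      simp only [Nat.add_sub_cancel, Nat.add_eq_zero_iff, one_ne_zero, and_false, if_false,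
        if_true, zero_mul, add_zero, ← Finset.sum_add_distrib, Finset.mul_sum]
      refine Finset.sum_congr rfl fun k _ => ?_
      have h : (n.descFactorial (k + 1) : ℝ) = (n - k) * n.descFactorial k := by
        rcases le_or_gt k n with hk | hk
        · rw [Nat.descFactorial_succ, Nat.cast_mul, Nat.cast_sub hk]
        · rw [Nat.descFactorial_eq_zero_iff_lt.mpr hk, Nat.descFactorial_eq_zero_iff_lt.mpr
            (hk.trans (Nat.lt_succ_self k))]
          simp
      rw [h]; ring

/-- The reciprocals of the moments of a coordinate of a uniformly distributed point of the sphere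
are products of a polynomial of degree `d / 2` and the moments of a measure on `[0, 1]`. -/
theorem exists_measure_coeff_mul_moment_eq_one {d : ℕ} (hd : 2 ≤ d) :
    ∃ (ν : Measure ℝ) (a : ℕ → ℝ), IsFiniteMeasure ν ∧ (∀ᵐ ρ ∂ν, ρ ∈ Icc (0 : ℝ) 1) ∧
      ∀ n : ℕ, (Real.Gamma (d / 2) * Real.Gamma ((n + 1) / 2) /
        (Real.Gamma (1 / 2) * Real.Gamma ((n + d) / 2))) * (∫ ρ, ρ ^ n ∂ν) *
        (∑ k ∈ Finset.range (d / 2 + 1), a k * n.descFactorial k) = 1 := by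
  obtain ⟨a, -, ha⟩ := exists_sum_descFactorial_eq_Gamma_div (d / 2)
  -- It is enough to get a nonzero constant independent of `n`; it is absorbed into the
  -- coefficients.
  suffices H : ∃ (ν : Measure ℝ) (C : ℝ), IsFiniteMeasure ν ∧ (∀ᵐ ρ ∂ν, ρ ∈ Icc (0 : ℝ) 1) ∧
      C ≠ 0 ∧ ∀ n : ℕ, (Real.Gamma (d / 2) * Real.Gamma ((n + 1) / 2) /
        (Real.Gamma (1 / 2) * Real.Gamma ((n + d) / 2))) * (∫ ρ, ρ ^ n ∂ν) *
        (Real.Gamma ((n + 1) / 2 + (d / 2 : ℕ)) / Real.Gamma ((n + 1) / 2)) = C by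
    obtain ⟨ν, C, h1, h2, hC, h3⟩ := H
    refine ⟨ν, fun k => a k / C, h1, h2, fun n => ?_⟩
    have := h3 n
    rw [← ha n] at this
    simp only [div_mul_eq_mul_div _ C]
    rw [← Finset.sum_div, ← mul_div_assoc, this, div_self hC]
  have hG : ∀ x : ℝ, 0 < x → Real.Gamma x ≠ 0 := fun x hx => (Real.Gamma_pos_of_pos hx).ne'
  have hd0 : (0 : ℝ) < d := by exact_mod_cast (by omega : 0 < d)
  rcases Nat.even_or_odd' d with ⟨m, rfl | rfl⟩
  -- Even dimension: the factor still needed is `Γ(m + n/2) / Γ(m + n/2 + 1/2)`, up to a constant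
  -- the `n`-th moment of the square root of a Beta(`m`, `1/2`) variable.
  · have hm : 0 < (m : ℝ) := by exact_mod_cast (by omega : 0 < m)
    have hm2 : 2 * m / 2 = m := by omega
    have := ProbabilityTheory.isProbabilityMeasureBeta hm (one_half_pos (α := ℝ))
    have hb := ProbabilityTheory.beta_pos hm (one_half_pos (α := ℝ))
    refine ⟨(ProbabilityTheory.betaMeasure m (1 / 2)).map Real.sqrt,
      Real.Gamma ((2 * m : ℕ) / 2) / ProbabilityTheory.beta m (1 / 2),
      inferInstance, ?_, ?_, fun n => ?_⟩
    · refine (ae_map_iff Real.continuous_sqrt.aemeasurable measurableSet_Icc).mpr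
        ((ae_withDensity_iff
          (ProbabilityTheory.measurable_betaPDFReal _ _).ennreal_ofReal).mpr ?_)
      refine Filter.Eventually.of_forall fun u hu => ⟨Real.sqrt_nonneg u, ?_⟩
      refine Real.sqrt_le_one.mpr ?_
      by_contra! h
      exact hu (ProbabilityTheory.betaPDF_eq_zero_of_one_le h.le)
    · exact div_ne_zero (hG _ (by positivity)) hb.ne'
    · rw [integral_map Real.continuous_sqrt.aemeasurable (by fun_prop),
        integral_sqrt_pow_betaMeasure hm one_half_pos, hm2]
      have e1 : ((n : ℝ) + (2 * m : ℕ)) / 2 = m + n / 2 := by push_cast; ring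
      have e2 : ((n : ℝ) + 1) / 2 + m = m + n / 2 + 1 / 2 := by ring
      have e3 : ProbabilityTheory.beta (m + n / 2) (1 / 2) = Real.Gamma (m + n / 2) *
        Real.Gamma (1 / 2) / Real.Gamma (m + n / 2 + 1 / 2) := rfl
      rw [e1, e2, e3]
      have g1 := hG (((n : ℝ) + 1) / 2) (by positivity)
      have g2 := hG (m + (n : ℝ) / 2) (by positivity)
      have g3 := hG (m + (n : ℝ) / 2 + 1 / 2) (by positivity)
      have g4 := hG (1 / 2) (by positivity)
      field_simp
  -- Odd dimension: `(n + d) / 2 = (n + 1) / 2 + m`, so the polynomial suffices and `ν` is a point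
  -- mass at `1`.
  · have hm2 : (2 * m + 1) / 2 = m := by omega
    refine ⟨Measure.dirac 1, Real.Gamma ((2 * m + 1 : ℕ) / 2) / Real.Gamma (1 / 2),
      inferInstance, ?_, ?_, fun n => ?_⟩
    · exact (ae_dirac_iff measurableSet_Icc).mpr (by simp)
    · exact div_ne_zero (hG _ (by positivity)) (hG _ (by positivity))
    · have e1 : ((n : ℝ) + (2 * m + 1 : ℕ)) / 2 = (n + 1) / 2 + m := by push_cast; ring
      rw [integral_dirac, hm2, e1]
      have g1 := hG (((n : ℝ) + 1) / 2) (by positivity)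
      have g2 := hG (((n : ℝ) + 1) / 2 + m) (by positivity)
      have g4 := hG (1 / 2) (by positivity)
      rw [one_pow]
      field_simp

/-! ### Polynomial approximation with derivatives and inversion of the Euler operator. -/

theorem exists_polynomial_derivative_eq (Q : Polynomial ℝ) :
    ∃ P : Polynomial ℝ, Polynomial.derivative P = Q := by
  induction Q using Polynomial.induction_on' with
  | add p q hp hq =>
    obtain ⟨P, hP⟩ := hp
    obtain ⟨Q, hQ⟩ := hq
    exact ⟨P + Q, by rw [Polynomial.derivative_add, hP, hQ]⟩
  | monomial n c =>
    refine ⟨Polynomial.monomial (n + 1) (c / (n + 1)), ?_⟩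
    rw [Polynomial.derivative_monomial]
    have : (n : ℝ) + 1 ≠ 0 := by positivity
    simp [this]

/-- Simultaneous approximation of a function and its first `m` derivatives by a polynomial. -/
theorem exists_polynomial_iterate_derivative_near {m : ℕ} {G : ℕ → ℝ → ℝ}
    (hG : ∀ k < m, ∀ x ∈ Ici (0 : ℝ), HasDerivWithinAt (G k) (G (k + 1) x) (Ici 0) x)
    (hGm : ContinuousOn (G m) (Ici 0)) {R ε : ℝ} (hR : 0 ≤ R) (hε : 0 < ε) :
    ∃ P : Polynomial ℝ, ∀ k ≤ m, ∀ x ∈ Icc 0 R,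
      |(Polynomial.derivative^[k] P).eval x - G k x| ≤ ε := by
  induction m generalizing G ε with
  | zero =>
    obtain ⟨P, hP⟩ := exists_polynomial_near_of_continuousOn 0 R (G 0)
      (hGm.mono Icc_subset_Ici_self) ε hε
    exact ⟨P, fun k hk x hx => by
      obtain rfl : k = 0 := by omega
      exact (hP x hx).le⟩
  | succ m ih =>
    -- Approximate the derivative and integrate. Integration over `[0, R]` costs a factor at most
    -- `R`, hence the tolerance `ε / (1 + R)`; the additive constant then matches the values at `0`.
    obtain ⟨Q, hQ⟩ := ih (G := fun k => G (k + 1)) (fun k hk => hG (k + 1) (by omega)) hGm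
      (ε := ε / (1 + R)) (by positivity)
    obtain ⟨P₀, hP₀⟩ := exists_polynomial_derivative_eq Q
    have hle : ε / (1 + R) ≤ ε := div_le_self hε.le (by linarith)
    refine ⟨P₀ + Polynomial.C (G 0 0 - P₀.eval 0), fun k hk x hx => ?_⟩
    have hder : Polynomial.derivative (P₀ + Polynomial.C (G 0 0 - P₀.eval 0)) = Q := by simp [hP₀]
    cases k with
    | succ k =>
      rw [Function.iterate_succ_apply, hder]
      exact (hQ k (by omega) x hx).trans hle
    | zero =>
      set P := P₀ + Polynomial.C (G 0 0 - P₀.eval 0) with hP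
      have h1 : ∀ y ∈ Icc 0 R, HasDerivWithinAt (fun y => P.eval y - G 0 y)
          (Q.eval y - G 1 y) (Icc 0 R) y := by
        intro y hy
        have := P.hasDerivAt y
        rw [hder] at this
        exact this.hasDerivWithinAt.sub ((hG 0 (by omega) y hy.1).mono Icc_subset_Ici_self)
      have h2 := (convex_Icc 0 R).norm_image_sub_le_of_norm_hasDerivWithin_le h1
        (fun y hy => hQ 0 (by omega) y hy) (left_mem_Icc.mpr hR) hx
      have h3 : P.eval 0 - G 0 0 = 0 := by simp [hP]
      rw [h3, sub_zero, sub_zero, Real.norm_eq_abs, Real.norm_eq_abs, abs_of_nonneg hx.1] at h2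
      refine h2.trans ?_
      rw [div_mul_eq_mul_div, div_le_iff₀ (by linarith)]
      have := hx.2
      gcongr; linarith

/-- The Euler-type differential operator `∑ aₖ xᵏ ∂ᵏ` applied to a jet, evenly extended. -/
def eulerOp (a : ℕ → ℝ) (m : ℕ) (G : ℕ → ℝ → ℝ) (x : ℝ) : ℝ :=
  ∑ k ∈ Finset.range (m + 1), a k * |x| ^ k * G k |x|

theorem continuous_eulerOp {a : ℕ → ℝ} {m : ℕ} {G : ℕ → ℝ → ℝ}
    (hG : ∀ k ≤ m, ContinuousOn (G k) (Ici 0)) : Continuous (eulerOp a m G) := by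
  refine continuous_finsetSum _ fun k hk => ?_
  have h : Continuous fun x : ℝ => G k |x| :=
    (hG k (Nat.lt_succ_iff.mp (Finset.mem_range.mp hk))).comp_continuous continuous_abs
      fun x => abs_nonneg x
  exact (continuous_const.mul (continuous_abs.pow k)).mul h

theorem abs_eulerOp_sub_le {a : ℕ → ℝ} {m : ℕ} {G H : ℕ → ℝ → ℝ} {R ε : ℝ}
    (h : ∀ k ≤ m, ∀ x ∈ Icc 0 R, |H k x - G k x| ≤ ε) {x : ℝ} (hx : |x| ≤ R) :
    |eulerOp a m H x - eulerOp a m G x| ≤ (∑ k ∈ Finset.range (m + 1), |a k| * R ^ k) * ε := by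
  rw [eulerOp, eulerOp, ← Finset.sum_sub_distrib, Finset.sum_mul]
  refine (Finset.abs_sum_le_sum_abs _ _).trans (Finset.sum_le_sum fun k hk => ?_)
  rw [← mul_sub, abs_mul, abs_mul, abs_pow, abs_abs]
  have h1 := h k (Nat.lt_succ_iff.mp (Finset.mem_range.mp hk)) |x| ⟨abs_nonneg x, hx⟩
  have hR : 0 ≤ R := (abs_nonneg x).trans hx
  gcongr

section Moment

variable {X : Type*} [MeasurableSpace X] {μ : Measure X} [IsFiniteMeasure μ] {u : X → ℝ}

theorem integrable_continuous_comp_of_mem_Icc (hu : Measurable u)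
    (hu1 : ∀ᵐ x ∂μ, u x ∈ Icc (0 : ℝ) 1) {K : ℝ → ℝ} (hK : Continuous K) (r : ℝ) :
    Integrable (fun x => K (r * u x)) μ := by
  obtain ⟨C, hC⟩ := (isCompact_Icc (a := (0 : ℝ)) (b := 1)).exists_bound_of_continuousOn
    (f := fun t => K (r * t)) (by fun_prop)
  refine Integrable.of_bound (by fun_prop) C ?_
  filter_upwards [hu1] with x hx using hC _ hx

theorem continuous_eulerOp_polynomial (a : ℕ → ℝ) (m : ℕ) (P : Polynomial ℝ) :
    Continuous (eulerOp a m fun k x => (Polynomial.derivative^[k] P).eval x) :=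
  continuous_eulerOp fun _ _ => (Polynomial.continuous _).continuousOn

/-- Monomials are eigenfunctions both of the Euler operator and of averaging over dilations by `u`;
`hmom` says that the two eigenvalues are reciprocal. -/
theorem integral_eulerOp_polynomial {a : ℕ → ℝ} {m : ℕ} (hu : Measurable u)
    (hu1 : ∀ᵐ x ∂μ, u x ∈ Icc (0 : ℝ) 1)
    (hmom : ∀ n : ℕ, (∫ x, u x ^ n ∂μ) *
      (∑ k ∈ Finset.range (m + 1), a k * n.descFactorial k) = 1)
    {r : ℝ} (hr : 0 ≤ r) (P : Polynomial ℝ) :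
    ∫ x, eulerOp a m (fun k x => (Polynomial.derivative^[k] P).eval x) (r * u x) ∂μ =
      P.eval r := by
  induction P using Polynomial.induction_on' with
  | add p q hp hq =>
    rw [Polynomial.eval_add, ← hp, ← hq, ← integral_add
      (integrable_continuous_comp_of_mem_Icc hu hu1 (continuous_eulerOp_polynomial a m p) r)
      (integrable_continuous_comp_of_mem_Icc hu hu1 (continuous_eulerOp_polynomial a m q) r)]
    congr 1; funext x
    simp [eulerOp, iterate_map_add, mul_add, Finset.sum_add_distrib]
  | monomial n c =>
    have e : ∀ y : ℝ, eulerOp a m (fun k x =>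
        (Polynomial.derivative^[k] (Polynomial.monomial n c)).eval x) y =
        c * (∑ k ∈ Finset.range (m + 1), a k * n.descFactorial k) * |y| ^ n := by
      intro y
      rw [eulerOp, Finset.mul_sum, Finset.sum_mul]
      refine Finset.sum_congr rfl fun k _ => ?_
      rw [← Polynomial.C_mul_X_pow_eq_monomial, Polynomial.iterate_derivative_C_mul,
        Polynomial.iterate_derivative_X_pow_eq_natCast_mul]
      rcases le_or_gt k n with hk | hk
      · simp only [Polynomial.eval_mul, Polynomial.eval_C, Polynomial.eval_natCast,
          Polynomial.eval_pow, Polynomial.eval_X]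
        rw [← Nat.add_sub_cancel' hk]
        simp only [Nat.add_sub_cancel_left, pow_add]
        ring
      · simp [Nat.descFactorial_eq_zero_iff_lt.mpr hk]
    simp only [e]
    rw [integral_const_mul]
    have h2 : ∫ x, |r * u x| ^ n ∂μ = r ^ n * ∫ x, u x ^ n ∂μ := by
      rw [← integral_const_mul]
      refine integral_congr_ae ?_
      filter_upwards [hu1] with x hx
      rw [abs_of_nonneg (mul_nonneg hr hx.1), mul_pow]
    rw [h2, Polynomial.eval_monomial]
    linear_combination c * r ^ n * hmom n

/-- If the moments of `u` are reciprocal to the symbol of the Euler operator, then averaging over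
`u` inverts the operator. -/
theorem integral_eulerOp_eq {a : ℕ → ℝ} {m : ℕ} (hu : Measurable u)
    (hu1 : ∀ᵐ x ∂μ, u x ∈ Icc (0 : ℝ) 1)
    (hmom : ∀ n : ℕ, (∫ x, u x ^ n ∂μ) *
      (∑ k ∈ Finset.range (m + 1), a k * n.descFactorial k) = 1)
    {G : ℕ → ℝ → ℝ}
    (hG : ∀ k < m, ∀ x ∈ Ici (0 : ℝ), HasDerivWithinAt (G k) (G (k + 1) x) (Ici 0) x)
    (hGc : ∀ k ≤ m, ContinuousOn (G k) (Ici 0)) {r : ℝ} (hr : 0 ≤ r) :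
    ∫ x, eulerOp a m G (r * u x) ∂μ = G 0 r := by
  set A := ∑ k ∈ Finset.range (m + 1), |a k| * r ^ k with hA
  have hA0 : 0 ≤ A := Finset.sum_nonneg fun k _ => by positivity
  -- For an approximating polynomial the identity is exact. The error `A * μ.real univ * ε` comes
  -- from the operator on `[0, r]`, the extra `ε` from the value at `r`.
  have key : ∀ ε > 0, |∫ x, eulerOp a m G (r * u x) ∂μ - G 0 r| ≤
      (A * μ.real univ + 1) * ε := by
    intro ε hε
    obtain ⟨P, hP⟩ := exists_polynomial_iterate_derivative_near hG (hGc m le_rfl) hr hε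
    have h1 := integral_eulerOp_polynomial hu hu1 hmom hr P
    have h2 := hP 0 (Nat.zero_le _) r (right_mem_Icc.mpr hr)
    rw [Function.iterate_zero, id, ← h1] at h2
    have h3 : |∫ x, eulerOp a m (fun k x => (Polynomial.derivative^[k] P).eval x) (r * u x) ∂μ -
        ∫ x, eulerOp a m G (r * u x) ∂μ| ≤ A * ε * μ.real univ := by
      rw [← integral_sub
        (integrable_continuous_comp_of_mem_Icc hu hu1 (continuous_eulerOp_polynomial a m P) r)
        (integrable_continuous_comp_of_mem_Icc hu hu1 (continuous_eulerOp hGc) r)]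
      rw [← Real.norm_eq_abs]
      refine norm_integral_le_of_norm_le_const ?_
      filter_upwards [hu1] with x hx
      refine abs_eulerOp_sub_le hP ?_
      rw [abs_of_nonneg (mul_nonneg hr hx.1)]
      exact mul_le_of_le_one_right hr hx.2
    rw [abs_le] at *
    constructor <;> nlinarith
  rw [← sub_eq_zero, ← abs_nonpos_iff]
  refine le_of_forall_pos_le_add fun ε hε => ?_
  have hB : 0 < A * μ.real univ + 1 := by positivity
  have := key (ε / (A * μ.real univ + 1)) (by positivity)
  rwa [mul_div_cancel₀ _ hB.ne', ← zero_add ε] at this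

end Moment

/-! ### Polynomial growth and multiplicative averages. -/

theorem exists_growth_bound_of_continuousOn {g : ℝ → ℝ} (hg : ContinuousOn g (Ici 0))
    {c k R : ℝ} (hc : 0 ≤ c) (hk0 : 0 ≤ k)
    (hk : ∀ x : ℝ, R < x → |g x| ≤ c * x ^ k) :
    ∃ (C : ℝ) (N : ℕ), 0 ≤ C ∧ ∀ x ∈ Ici (0 : ℝ), |g x| ≤ C * (1 + x) ^ N := by
  obtain ⟨B, hB⟩ := (isCompact_Icc (a := (0 : ℝ)) (b := R)).exists_bound_of_continuousOn
    (hg.mono Icc_subset_Ici_self)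
  refine ⟨max B 0 + c, ⌈k⌉₊, by positivity, fun x hx => ?_⟩
  have hx0 : 0 ≤ x := hx
  have h1 : 1 ≤ (1 + x) ^ ⌈k⌉₊ := one_le_pow₀ (by linarith)
  rw [add_mul]
  rcases le_or_gt x R with h | h
  · calc |g x| ≤ max B 0 * 1 := by rw [mul_one]; exact (hB x ⟨hx, h⟩).trans (le_max_left _ _)
      _ ≤ max B 0 * (1 + x) ^ ⌈k⌉₊ := by gcongr
      _ ≤ _ := le_add_of_nonneg_right (by positivity)
  · have h2 : x ^ k ≤ (1 + x) ^ ⌈k⌉₊ :=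
      calc x ^ k ≤ (1 + x) ^ k := Real.rpow_le_rpow hx0 (by linarith) hk0
        _ ≤ (1 + x) ^ (⌈k⌉₊ : ℝ) := Real.rpow_le_rpow_of_exponent_le (by linarith) (Nat.le_ceil k)
        _ = _ := Real.rpow_natCast _ _
    calc |g x| ≤ c * x ^ k := hk x h
      _ ≤ c * (1 + x) ^ ⌈k⌉₊ := by gcongr
      _ ≤ _ := le_add_of_nonneg_left (by positivity)

/-- If the highest derivative grows at most polynomially, so do the lower ones. -/
theorem exists_growth_bound {m : ℕ} {G : ℕ → ℝ → ℝ}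
    (hG : ∀ k < m, ∀ x ∈ Ici (0 : ℝ), HasDerivWithinAt (G k) (G (k + 1) x) (Ici 0) x)
    {C : ℝ} {N : ℕ} (hC : 0 ≤ C) (hm : ∀ x ∈ Ici (0 : ℝ), |G m x| ≤ C * (1 + x) ^ N) :
    ∃ (C : ℝ) (N : ℕ), 0 ≤ C ∧ ∀ k ≤ m, ∀ x ∈ Ici (0 : ℝ), |G k x| ≤ C * (1 + x) ^ N := by
  induction m generalizing G with
  | zero =>
    exact ⟨C, N, hC, fun k hk => by obtain rfl : k = 0 := by omega
                                    exact hm⟩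
  | succ m ih =>
    obtain ⟨C, N, hC, h⟩ := ih (G := fun k => G (k + 1)) (fun k hk => hG (k + 1) (by omega)) hm
    refine ⟨|G 0 0| + C, N + 1, by positivity, fun k hk x hx => ?_⟩
    have hx0 : 0 ≤ x := hx
    have h1 : 1 ≤ (1 + x) ^ N := one_le_pow₀ (by linarith)
    cases k with
    | succ k =>
      calc |G (k + 1) x| ≤ C * (1 + x) ^ N := h k (by omega) x hx
        _ ≤ (|G 0 0| + C) * (1 + x) ^ (N + 1) := by
          gcongr
          · linarith [abs_nonneg (G 0 0)]
          · linarith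
          · omega
    | zero =>
      have h2 := (convex_Icc 0 x).norm_image_sub_le_of_norm_hasDerivWithin_le
        (f := G 0) (f' := G 1) (C := C * (1 + x) ^ N)
        (fun y hy => (hG 0 (by omega) y hy.1).mono Icc_subset_Ici_self)
        (fun y hy => (h 0 (by omega) y hy.1).trans (by
          have := hy.1
          have := hy.2
          gcongr))
        (left_mem_Icc.mpr hx0) (right_mem_Icc.mpr hx0)
      rw [sub_zero, Real.norm_eq_abs, Real.norm_eq_abs, abs_of_nonneg hx0] at h2
      have h3 : |G 0 x| ≤ |G 0 0| + C * (1 + x) ^ N * x := by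
        have := abs_sub_abs_le_abs_sub (G 0 x) (G 0 0)
        linarith
      calc |G 0 x| ≤ |G 0 0| * 1 + C * (1 + x) ^ N * x := by rw [mul_one]; exact h3
        _ ≤ |G 0 0| * (1 + x) ^ (N + 1) + C * (1 + x) ^ N * (1 + x) := by
          gcongr
          · exact one_le_pow₀ (by linarith)
          · linarith
        _ = _ := by ring

theorem abs_eulerOp_le {a : ℕ → ℝ} {m : ℕ} {G : ℕ → ℝ → ℝ} {C : ℝ} {N : ℕ}
    (h : ∀ k ≤ m, ∀ x ∈ Ici (0 : ℝ), |G k x| ≤ C * (1 + x) ^ N) (x : ℝ) :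
    |eulerOp a m G x| ≤ ((∑ k ∈ Finset.range (m + 1), |a k|) * C) * (1 + |x|) ^ (m + N) := by
  rw [eulerOp, Finset.sum_mul, Finset.sum_mul]
  refine (Finset.abs_sum_le_sum_abs _ _).trans (Finset.sum_le_sum fun k hk => ?_)
  have hk' : k ≤ m := Nat.lt_succ_iff.mp (Finset.mem_range.mp hk)
  rw [abs_mul, abs_mul, abs_pow, abs_abs]
  have h1 := h k hk' |x| (abs_nonneg x)
  have h2 : |x| ^ k ≤ (1 + |x|) ^ m :=
    calc |x| ^ k ≤ (1 + |x|) ^ k := by gcongr; linarith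
      _ ≤ _ := by gcongr; linarith [abs_nonneg x]
  calc |a k| * |x| ^ k * |G k (|x|)| ≤ |a k| * (1 + |x|) ^ m * (C * (1 + |x|) ^ N) := by gcongr
    _ = _ := by ring

/-- Multiplicative averages of a function over a measure on `[0, 1]`. -/
def scaleAvg (ν : Measure ℝ) (K : ℝ → ℝ) (t : ℝ) : ℝ := ∫ ρ, K (t * ρ) ∂ν

section ScaleAvg

variable {ν : Measure ℝ} [IsFiniteMeasure ν] {K : ℝ → ℝ} {C : ℝ} {N : ℕ}

theorem abs_comp_mul_le (hC : 0 ≤ C) (hK : ∀ x, |K x| ≤ C * (1 + |x|) ^ N) {t ρ : ℝ}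
    (hρ : ρ ∈ Icc (0 : ℝ) 1) : |K (t * ρ)| ≤ C * (1 + |t|) ^ N := by
  refine (hK _).trans ?_
  have : |t * ρ| ≤ |t| := by
    rw [abs_mul, abs_of_nonneg hρ.1]
    exact mul_le_of_le_one_right (abs_nonneg _) hρ.2
  gcongr

theorem abs_scaleAvg_le (hν : ∀ᵐ ρ ∂ν, ρ ∈ Icc (0 : ℝ) 1) (hC : 0 ≤ C)
    (hK : ∀ x, |K x| ≤ C * (1 + |x|) ^ N) (t : ℝ) :
    |scaleAvg ν K t| ≤ (C * ν.real univ) * (1 + |t|) ^ N := by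
  have := norm_integral_le_of_norm_le_const (μ := ν) (f := fun ρ => K (t * ρ))
    (C := C * (1 + |t|) ^ N) (by
      filter_upwards [hν] with ρ hρ using abs_comp_mul_le hC hK hρ)
  rw [scaleAvg, ← Real.norm_eq_abs]
  exact this.trans_eq (by ring)

theorem continuous_scaleAvg (hν : ∀ᵐ ρ ∂ν, ρ ∈ Icc (0 : ℝ) 1) (hKc : Continuous K) (hC : 0 ≤ C)
    (hK : ∀ x, |K x| ≤ C * (1 + |x|) ^ N) : Continuous (scaleAvg ν K) := by
  rw [continuous_iff_continuousAt]
  intro t₀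
  refine continuousAt_of_dominated (bound := fun _ => C * (1 + (|t₀| + 1)) ^ N) ?_ ?_
    (integrable_const _) ?_
  · exact Filter.Eventually.of_forall fun t => by fun_prop
  · have : ∀ᶠ t in nhds t₀, |t| < |t₀| + 1 :=
      continuous_abs.continuousAt.eventually_lt_const (by linarith)
    filter_upwards [this] with t ht
    filter_upwards [hν] with ρ hρ
    refine (abs_comp_mul_le hC hK hρ).trans ?_
    gcongr
  · exact Filter.Eventually.of_forall fun ρ => by fun_prop

end ScaleAvg

/-! ### Fourier analysis of ridge functions. -/

/-- The Fourier transform commutes with reflection, hence with taking the even part. -/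
theorem fourier_averageOne_fourierInv (ψ : 𝓢(ℝ, ℂ)) :
    𝓕 (averageOne (𝓕⁻ ψ)) = averageOne ψ := by
  have h : ∀ χ : 𝓢(ℝ, ℂ), 𝓕 (SchwartzMap.compCLMOfContinuousLinearEquiv ℂ
      (ContinuousLinearEquiv.neg ℝ) χ) =
      SchwartzMap.compCLMOfContinuousLinearEquiv ℂ (ContinuousLinearEquiv.neg ℝ) (𝓕 χ) := by
    intro χ
    ext t
    have h1 := congrFun (Real.fourierInv_eq_fourier_comp_neg (χ : ℝ → ℂ)) t
    have h2 := Real.fourierInv_eq_fourier_neg (χ : ℝ → ℂ) t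
    rw [SchwartzMap.fourier_coe]
    exact h1.symm.trans h2
  simp only [averageOne, smul_apply, add_apply, ContinuousLinearMap.id_apply,
    FourierTransform.fourier_smul, FourierTransform.fourier_add, h,
    FourierTransform.fourier_fourierInv_eq]

theorem norm_mul_schwartz_le {E : Type*} [NormedAddCommGroup E] [InnerProductSpace ℝ E]
    {g : E → ℂ} {C : ℝ} {N : ℕ}
    (hg : ∀ x, ‖g x‖ ≤ C * (1 + ‖x‖) ^ N) (φ : 𝓢(E, ℂ)) (x : E) :
    ‖g x * φ x‖ ≤ C * ((1 + ‖x‖) ^ N * ‖φ x‖) := by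
  rw [norm_mul, ← mul_assoc]
  exact mul_le_mul_of_nonneg_right (hg x) (norm_nonneg _)

section Slice

variable {E : Type*} [NormedAddCommGroup E] [InnerProductSpace ℝ E] [FiniteDimensional ℝ E]
  [MeasurableSpace E] [BorelSpace E]

/-- A form of the Fourier slice theorem: integrating ridge functions against a Schwartz function
on `E` only involves the restriction of its inverse Fourier transform to a line. -/
theorem integral_ridge_mul (χ : 𝓢(ℝ, ℂ)) (Φ : 𝓢(E, ℂ)) (ξ : E) :
    ∫ x, χ ⟪ξ, x⟫ * Φ x = ∫ s : ℝ, 𝓕 χ s * 𝓕⁻ Φ (s • ξ) := by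
  -- The sign cancels the one in the Fourier kernel, so both transforms along `L` are inverse ones;
  -- the claim is then their duality, that is, Fubini.
  let L : ℝ →ₗ[ℝ] E →ₗ[ℝ] ℝ := -(LinearMap.toSpanSingleton ℝ _ (innerₗ E ξ))
  have hL : ∀ (s : ℝ) (x : E), L s x = -(s * ⟪ξ, x⟫) := fun s x => by simp [L]
  have hLc : Continuous fun p : ℝ × E => L p.1 p.2 := by
    simp only [hL]; fun_prop
  have := VectorFourier.integral_fourierIntegral_smul_eq_flip (μ := volume) (ν := volume)
    (L := L) Real.continuous_fourierChar hLc (𝓕 χ).integrable Φ.integrable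
  have e1 : ∀ x : E, VectorFourier.fourierIntegral Real.fourierChar volume L
      (𝓕 χ : 𝓢(ℝ, ℂ)) x =
      χ ⟪ξ, x⟫ := by
    intro x
    have h : χ ⟪ξ, x⟫ = 𝓕⁻ (𝓕 χ) ⟪ξ, x⟫ := by rw [FourierTransform.fourierInv_fourier_eq]
    rw [h, SchwartzMap.fourierInv_coe, Real.fourierInv_eq, VectorFourier.fourierIntegral]
    simp [hL, mul_comm]
  have e2 : ∀ s : ℝ, VectorFourier.fourierIntegral Real.fourierChar volume L.flip Φ s =
      𝓕⁻ Φ (s • ξ) := by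
    intro s
    rw [SchwartzMap.fourierInv_coe, Real.fourierInv_eq, VectorFourier.fourierIntegral]
    simp [hL, inner_smul_right, real_inner_comm]
  simpa only [e1, e2, smul_eq_mul] using this

/-- Restricted to the line through a unit vector, a radial function with even profile is that
profile. The dimension of `E` thus disappears and the one-dimensional duality of the Fourier
transform finishes. -/
theorem integral_schwartz_ridge_mul_fourier_rotateAvg (χ ψ : 𝓢(ℝ, ℂ)) {ξ : E} (hξ : ‖ξ‖ = 1) :
    ∫ x, χ ⟪ξ, x⟫ * 𝓕 (rotateAvg E (𝓕⁻ ψ)) x = ∫ t, χ t * averageOne ψ t := by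
  rw [integral_ridge_mul, FourierTransform.fourierInv_fourier_eq,
    ← fourier_averageOne_fourierInv ψ, ← SchwartzMap.integral_fourier_mul_eq]
  refine integral_congr_ae (Filter.Eventually.of_forall fun s => ?_)
  have : rotateAvg E (𝓕⁻ ψ) (s • ξ) = averageOne (𝓕⁻ ψ) s := by
    change averageOne (𝓕⁻ ψ) ‖s • ξ‖ = _
    rw [norm_smul, hξ, mul_one, Real.norm_eq_abs]
    rcases abs_choice s with h | h <;> rw [h]
    exact averageOne_even _ _
  simp only [this]

theorem integrable_one_add_norm_pow_mul (φ : 𝓢(E, ℂ)) (N : ℕ) :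
    Integrable fun x => (1 + ‖x‖) ^ N * ‖φ x‖ := by
  simp only [add_comm (1 : ℝ), add_pow, one_pow, mul_one, Finset.sum_mul]
  refine integrable_finsetSum _ fun k _ => ?_
  have := (φ.integrable_pow_mul volume k).const_mul (N.choose k : ℝ)
  refine this.congr (Filter.Eventually.of_forall fun x => ?_)
  simp only; ring

theorem integrable_mul_schwartz {g : E → ℂ} (hgc : Continuous g) {C : ℝ} {N : ℕ}
    (hg : ∀ x, ‖g x‖ ≤ C * (1 + ‖x‖) ^ N) (φ : 𝓢(E, ℂ)) :
    Integrable fun x => g x * φ x :=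
  ((integrable_one_add_norm_pow_mul φ N).const_mul C).mono'
    (hgc.mul φ.continuous).aestronglyMeasurable
    (Filter.Eventually.of_forall (norm_mul_schwartz_le hg φ))

/-- Continuous functions of polynomial growth generate tempered distributions. -/
theorem exists_isGeneratedBy {g : E → ℂ} (hgc : Continuous g) {C : ℝ} {N : ℕ} (hC : 0 ≤ C)
    (hg : ∀ x, ‖g x‖ ≤ C * (1 + ‖x‖) ^ N) :
    ∃ T : 𝓢'(E, ℂ), @IsGeneratedBy E _ _ measureSpaceOfInnerProductSpace T g := by
  have hi := integrable_mul_schwartz hgc hg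
  obtain ⟨n, hn⟩ := (inferInstance : (volume : Measure E).HasTemperateGrowth).exists_integrable
  let T : 𝓢(E, ℂ) →L[ℂ] ℂ := SchwartzMap.mkCLMtoNormedSpace (fun φ => ∫ x, g x * φ x)
    (fun φ χ => by simp only [add_apply, mul_add]; exact integral_add (hi φ) (hi χ))
    (fun a φ => by
      simp only [smul_apply, smul_eq_mul, RingHom.id_apply, ← integral_const_mul]
      congr 1; funext x; ring)
    (by
      -- Here `n` makes `(1 + ‖x‖) ^ (-n)` integrable; decay of order `n + N` in `φ` pays for this
      -- weight and for the growth of `g`.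
      refine ⟨Finset.Iic (n + N, 0), C * (∫ x : E, (1 + ‖x‖) ^ (-(n : ℝ))) * 2 ^ (n + N),
        by positivity, fun φ => ?_⟩
      have h1 : ∀ x, C * ((1 + ‖x‖) ^ N * ‖φ x‖) ≤ C * ((1 + ‖x‖) ^ (-(n : ℝ)) *
          (2 ^ (n + N) * ((Finset.Iic (n + N, 0)).sup
            (fun m => SchwartzMap.seminorm ℂ m.1 m.2) φ))) := by
        intro x
        refine mul_le_mul_of_nonneg_left ?_ hC
        rw [Real.rpow_neg (by positivity), ← div_eq_inv_mul, le_div_iff₀' (by positivity),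
          Real.rpow_natCast, ← mul_assoc, ← pow_add]
        simpa using SchwartzMap.one_add_le_sup_seminorm_apply (𝕜 := ℂ) (m := (n + N, 0))
          (k := n + N) (n := 0) le_rfl le_rfl φ x
      refine (norm_integral_le_of_norm_le
        ((integrable_one_add_norm_pow_mul φ N).const_mul C)
        (Filter.Eventually.of_forall (norm_mul_schwartz_le hg φ))).trans ?_
      refine (integral_mono ((integrable_one_add_norm_pow_mul φ N).const_mul C)
        ((hn.mul_const _).const_mul _) h1).trans_eq ?_
      rw [integral_const_mul, integral_mul_const]
      unfold schwartzSeminormFamily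
      ring)
  exact ⟨T, hgc.locallyIntegrable, fun φ => ⟨hi φ, rfl⟩⟩

end Slice

/-- Continuous functions of polynomial growth are limits of Schwartz functions, dominated by a
function of polynomial growth. -/
theorem exists_schwartz_tendsto {f : ℝ → ℂ} (hf : Continuous f) {C : ℝ} {N : ℕ}
    (hfb : ∀ t, ‖f t‖ ≤ C * (1 + |t|) ^ N) :
    ∃ χ : ℕ → 𝓢(ℝ, ℂ), (∀ n t, ‖χ n t‖ ≤ (C + 1) * (1 + |t|) ^ N) ∧
      ∀ t, Filter.Tendsto (fun n => χ n t) Filter.atTop (nhds (f t)) := by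
  have h1 : ∀ n : ℕ, ∃ g : ℝ → ℂ, ContDiff ℝ ∞ g ∧ ∀ t, dist (g t) (f t) < 1 / (n + 1 : ℝ) := by
    intro n
    obtain ⟨g, hg, hd, -⟩ := hf.exists_contDiff_approx ⊤ (ε := fun _ => 1 / (n + 1 : ℝ))
      continuous_const (fun _ => by positivity)
    exact ⟨g, hg, hd⟩
  choose g hg hgd using h1
  -- The cutoffs equal `1` at any given point for large `n`. The smooth approximants are within `1 /
  -- (n + 1) ≤ 1` of `f`, which accounts for `C + 1` in the bound.
  let b : (n : ℕ) → ContDiffBump (0 : ℝ) := fun n => ⟨n + 1, n + 2, by positivity, by linarith⟩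
  have hs : ∀ n, HasCompactSupport fun t => ((b n t : ℝ) : ℂ) * g n t := fun n =>
    ((b n).hasCompactSupport.comp_left Complex.ofReal_zero).mul_right
  have hsm : ∀ n, ContDiff ℝ ∞ fun t => ((b n t : ℝ) : ℂ) * g n t := fun n =>
    (Complex.ofRealCLM.contDiff.comp (b n).contDiff).mul (hg n)
  refine ⟨fun n => (hs n).toSchwartzMap (hsm n), fun n t => ?_, fun t => ?_⟩
  · change ‖((b n t : ℝ) : ℂ) * g n t‖ ≤ _
    rw [norm_mul, Complex.norm_real, Real.norm_eq_abs, abs_of_nonneg (b n).nonneg]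
    have h2 : ‖g n t‖ ≤ ‖f t‖ + 1 := by
      have h3 := (hgd n t).le
      rw [dist_eq_norm] at h3
      have h4 : 1 / (n + 1 : ℝ) ≤ 1 := by
        rw [div_le_one (by positivity)]; linarith [n.cast_nonneg (α := ℝ)]
      linarith [norm_sub_norm_le (g n t) (f t)]
    have h5 : 1 ≤ (1 + |t|) ^ N := one_le_pow₀ (by linarith [abs_nonneg t])
    calc b n t * ‖g n t‖ ≤ 1 * ‖g n t‖ := by gcongr; exact (b n).le_one
      _ ≤ _ := by linarith [hfb t]
  · have h2 : Filter.Tendsto (fun n => g n t) Filter.atTop (nhds (f t)) := by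
      rw [tendsto_iff_dist_tendsto_zero]
      exact squeeze_zero (fun _ => dist_nonneg) (fun n => (hgd n t).le)
        tendsto_one_div_add_atTop_nhds_zero_nat
    refine h2.congr' ?_
    filter_upwards [Filter.eventually_ge_atTop ⌈|t|⌉₊] with n hn
    change g n t = ((b n t : ℝ) : ℂ) * g n t
    have : |t| ≤ n := (Nat.le_ceil _).trans (by exact_mod_cast hn)
    rw [(b n).one_of_mem_closedBall, Complex.ofReal_one, one_mul]
    rw [mem_closedBall_zero_iff, Real.norm_eq_abs]
    change |t| ≤ (n : ℝ) + 1
    linarith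

/-- Passage from Schwartz profiles to continuous ones of polynomial growth, by dominated convergence
on both sides; `|⟪ξ, x⟫| ≤ ‖x‖` carries the growth bound over to `E`. -/
theorem integral_ridge_mul_fourier_rotateAvg {E : Type*} [NormedAddCommGroup E]
    [InnerProductSpace ℝ E] [FiniteDimensional ℝ E] [MeasurableSpace E] [BorelSpace E]
    {f : ℝ → ℂ} (hf : Continuous f) {C : ℝ} {N : ℕ}
    (hfb : ∀ t, ‖f t‖ ≤ C * (1 + |t|) ^ N) (ψ : 𝓢(ℝ, ℂ)) {ξ : E} (hξ : ‖ξ‖ = 1) :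
    ∫ x, f ⟪ξ, x⟫ * 𝓕 (rotateAvg E (𝓕⁻ ψ)) x = ∫ t, f t * averageOne ψ t := by
  obtain ⟨χ, hχb, hχ⟩ := exists_schwartz_tendsto hf hfb
  have hC : 0 ≤ C + 1 := by
    have h := (norm_nonneg _).trans (hχb 0 0)
    simpa using h
  have h1 : Filter.Tendsto (fun n => ∫ x, χ n ⟪ξ, x⟫ * 𝓕 (rotateAvg E (𝓕⁻ ψ)) x) Filter.atTop
      (nhds (∫ x, f ⟪ξ, x⟫ * 𝓕 (rotateAvg E (𝓕⁻ ψ)) x)) := by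
    refine tendsto_integral_of_dominated_convergence _ (fun n => ?_)
      ((integrable_one_add_norm_pow_mul (𝓕 (rotateAvg E (𝓕⁻ ψ))) N).const_mul (C + 1))
      (fun n => Filter.Eventually.of_forall (norm_mul_schwartz_le (fun x => ?_) _))
      (Filter.Eventually.of_forall fun x => (hχ _).mul_const _)
    · have := (χ n).continuous
      have := (𝓕 (rotateAvg E (𝓕⁻ ψ))).continuous
      exact Continuous.aestronglyMeasurable (by fun_prop)
    · refine (hχb n _).trans ?_
      have : |⟪ξ, x⟫| ≤ ‖x‖ := by simpa [hξ] using abs_real_inner_le_norm ξ x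
      gcongr
  have h2 : Filter.Tendsto (fun n => ∫ t, χ n t * averageOne ψ t) Filter.atTop
      (nhds (∫ t, f t * averageOne ψ t)) := by
    refine tendsto_integral_of_dominated_convergence _ (fun n => ?_)
      ((integrable_one_add_norm_pow_mul (averageOne ψ) N).const_mul (C + 1))
      (fun n => Filter.Eventually.of_forall (norm_mul_schwartz_le (fun x => ?_) _))
      (Filter.Eventually.of_forall fun x => (hχ _).mul_const _)
    · exact ((χ n).continuous.mul (averageOne ψ).continuous).aestronglyMeasurable
    · exact hχb n x
  simp only [integral_schwartz_ridge_mul_fourier_rotateAvg _ ψ hξ] at h1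
  exact tendsto_nhds_unique h1 h2

/-! ### The slicing relation and the back-transformed distribution. -/

theorem scaleAvg_neg {ν : Measure ℝ} {K : ℝ → ℝ} (hK : ∀ x, K (-x) = K x) (t : ℝ) :
    scaleAvg ν K (-t) = scaleAvg ν K t := by
  simp only [scaleAvg, neg_mul, hK]

theorem scaleAvg_abs {ν : Measure ℝ} {K : ℝ → ℝ} (hK : ∀ x, K (-x) = K x) (t : ℝ) :
    scaleAvg ν K |t| = scaleAvg ν K t := by
  rcases abs_choice t with h | h <;> rw [h]
  exact scaleAvg_neg hK t

theorem integral_mul_averageOne {f : ℝ → ℂ} (hf : ∀ t, f (-t) = f t) {ψ : 𝓢(ℝ, ℂ)}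
    (hi : Integrable fun t => f t * ψ t) :
    ∫ t, f t * averageOne ψ t = ∫ t, f t * ψ t := by
  have h1 : ∫ t, f t * ψ (-t) = ∫ t, f t * ψ t := by
    rw [← integral_neg_eq_self]
    simp [hf]
  have h2 : Integrable fun t => f t * ψ (-t) := by
    have := hi.comp_neg
    simpa only [hf] using this
  have h3 : ∀ t, f t * averageOne ψ t = (f t * ψ t + f t * ψ (-t)) / 2 := fun t => by
    rw [averageOne_apply]; ring
  simp only [h3]
  rw [integral_div, integral_add hi h2, h1]
  ring

/-- Averaging the inverse operator over the sphere recovers the radial profile. -/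
theorem integral_scaleAvg_eulerOp_uniformSphere {d : ℕ} (hd : 1 ≤ d) {m : ℕ} {a : ℕ → ℝ}
    {ν : Measure ℝ} [IsFiniteMeasure ν] (hν : ∀ᵐ ρ ∂ν, ρ ∈ Icc (0 : ℝ) 1)
    (hmom : ∀ n : ℕ, (Real.Gamma (d / 2) * Real.Gamma ((n + 1) / 2) /
        (Real.Gamma (1 / 2) * Real.Gamma ((n + d) / 2))) * (∫ ρ, ρ ^ n ∂ν) *
        (∑ k ∈ Finset.range (m + 1), a k * n.descFactorial k) = 1)
    {G : ℕ → ℝ → ℝ}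
    (hG : ∀ k < m, ∀ x ∈ Ici (0 : ℝ), HasDerivWithinAt (G k) (G (k + 1) x) (Ici 0) x)
    (hGc : ∀ k ≤ m, ContinuousOn (G k) (Ici 0)) (z : EuclideanSpace ℝ (Fin d)) :
    ∫ ξ, scaleAvg ν (eulerOp a m G) |⟪z, (ξ : EuclideanSpace ℝ (Fin d))⟫| ∂(uniformSphere d) =
      G 0 ‖z‖ := by
  have := uniformSphere_isProbabilityMeasure hd
  obtain ⟨e, he, hze⟩ : ∃ e : EuclideanSpace ℝ (Fin d), ‖e‖ = 1 ∧ z = ‖z‖ • e := by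
    by_cases hz : z = 0
    · exact ⟨EuclideanSpace.single ⟨0, hd⟩ 1, by simp, by simp [hz]⟩
    · have hz' : ‖z‖ ≠ 0 := norm_ne_zero_iff.mpr hz
      exact ⟨‖z‖⁻¹ • z, by simp [norm_smul, hz'], by simp [smul_smul, hz']⟩
  -- On the product space the moments of `u` are the products of the spherical moments and those of
  -- `ν`, so one application of the inversion handles both averages.
  let u : Metric.sphere (0 : EuclideanSpace ℝ (Fin d)) 1 × ℝ → ℝ := fun p =>
    |⟪e, (p.1 : EuclideanSpace ℝ (Fin d))⟫| * p.2
  have hu : Measurable u := by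
    have : Continuous u := by fun_prop
    exact this.measurable
  have hu1 : ∀ᵐ p ∂(uniformSphere d).prod ν, u p ∈ Icc (0 : ℝ) 1 := by
    filter_upwards [Measure.quasiMeasurePreserving_snd.ae hν] with p hp
    have h1 : |⟪e, (p.1 : EuclideanSpace ℝ (Fin d))⟫| ≤ 1 := by
      simpa [he] using abs_real_inner_le_norm e (p.1 : EuclideanSpace ℝ (Fin d))
    exact ⟨mul_nonneg (abs_nonneg _) hp.1, mul_le_one₀ h1 hp.1 hp.2⟩
  have humom : ∀ n : ℕ, (∫ p, u p ^ n ∂(uniformSphere d).prod ν) *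
      (∑ k ∈ Finset.range (m + 1), a k * n.descFactorial k) = 1 := by
    intro n
    have h := hmom n
    rw [← integral_abs_inner_pow_uniformSphere hd he n] at h
    simp only [u, mul_pow]
    rw [integral_prod_mul (fun ξ : Metric.sphere (0 : EuclideanSpace ℝ (Fin d)) 1 =>
      |⟪e, (ξ : EuclideanSpace ℝ (Fin d))⟫| ^ n) (fun ρ : ℝ => ρ ^ n)]
    exact h
  rw [← integral_eulerOp_eq hu hu1 humom hG hGc (norm_nonneg z), integral_prod _
    (integrable_continuous_comp_of_mem_Icc hu hu1 (continuous_eulerOp hGc) ‖z‖)]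
  refine integral_congr_ae (Filter.Eventually.of_forall fun ξ => ?_)
  have : |⟪z, (ξ : EuclideanSpace ℝ (Fin d))⟫| =
      ‖z‖ * |⟪e, (ξ : EuclideanSpace ℝ (Fin d))⟫| := by
    conv_lhs => rw [hze]
    rw [real_inner_smul_left, abs_mul, abs_norm]
  simp only [scaleAvg, u, this, mul_assoc]

/-- If the radial function with profile `F` is the spherical average of ridge functions with
profile `f`, then `f` generates the back-transformed distribution. -/
theorem isGeneratedBy_fourierInv_rotationStar_fourier {d : ℕ} (hd : 1 ≤ d) {F f : ℝ → ℝ}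
    (hf : Continuous f) (hfe : ∀ t, f (-t) = f t) {C : ℝ} {N : ℕ} (hC : 0 ≤ C)
    (hfb : ∀ t, |f t| ≤ C * (1 + |t|) ^ N)
    (hFf : ∀ z : EuclideanSpace ℝ (Fin d),
      F ‖z‖ = ∫ ξ, f ⟪z, (ξ : EuclideanSpace ℝ (Fin d))⟫ ∂(uniformSphere d))
    {T : 𝓢'(EuclideanSpace ℝ (Fin d), ℂ)}
    (hT : IsGeneratedBy T (rotation fun r : ℝ => (F r : ℂ))) :
    IsGeneratedBy (𝓕⁻ (rotationStar (EuclideanSpace ℝ (Fin d)) (𝓕 T)))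
      (fun t : ℝ => (f t : ℂ)) := by
  have := uniformSphere_isProbabilityMeasure hd
  have hfc : Continuous fun t : ℝ => (f t : ℂ) := by fun_prop
  have hfcb : ∀ t, ‖(f t : ℂ)‖ ≤ C * (1 + ‖t‖) ^ N := fun t => by
    simpa using hfb t
  refine ⟨hfc.locallyIntegrable, fun ψ => ?_⟩
  have hi := integrable_mul_schwartz hfc hfcb ψ
  refine ⟨hi, ?_⟩
  set Φ := 𝓕 (rotateAvg (EuclideanSpace ℝ (Fin d)) (𝓕⁻ ψ)) with hΦ
  -- Each of the three operators acts on distributions by precomposition, so all of them move onto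
  -- the test function.
  have h0 : 𝓕⁻ (rotationStar (EuclideanSpace ℝ (Fin d)) (𝓕 T)) ψ = T Φ := rfl
  rw [h0, (hT.2 Φ).2]
  have h1 : ∀ x : EuclideanSpace ℝ (Fin d), rotation (fun r : ℝ => (F r : ℂ)) x * Φ x =
      ∫ ξ, (f ⟪(ξ : EuclideanSpace ℝ (Fin d)), x⟫ : ℂ) * Φ x ∂(uniformSphere d) := by
    intro x
    rw [integral_mul_const, integral_complex_ofReal, rotation, hFf x]
    simp only [real_inner_comm]
  simp only [h1]
  have hint : Integrable (Function.uncurry fun (x : EuclideanSpace ℝ (Fin d))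
      (ξ : Metric.sphere (0 : EuclideanSpace ℝ (Fin d)) 1) =>
        (f ⟪(ξ : EuclideanSpace ℝ (Fin d)), x⟫ : ℂ) * Φ x)
      ((volume : Measure (EuclideanSpace ℝ (Fin d))).prod (uniformSphere d)) := by
    have hb := (((integrable_one_add_norm_pow_mul Φ N).const_mul C).comp_fst (uniformSphere d))
    refine hb.mono' ?_ (Filter.Eventually.of_forall fun p => ?_)
    · have := Φ.continuous
      exact Continuous.aestronglyMeasurable (by unfold Function.uncurry; fun_prop)
    · have h2 : |⟪(p.2 : EuclideanSpace ℝ (Fin d)), p.1⟫| ≤ ‖p.1‖ := by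
        simpa using abs_real_inner_le_norm (p.2 : EuclideanSpace ℝ (Fin d)) p.1
      simp only [Function.uncurry, norm_mul]
      rw [← mul_assoc]
      refine mul_le_mul_of_nonneg_right ((hfcb _).trans ?_) (norm_nonneg _)
      rw [Real.norm_eq_abs]
      gcongr
  rw [integral_integral_swap hint]
  -- After Fubini the inner integral is the same for every direction `ξ`, so the average over a
  -- probability measure is trivial. Evenness of `f` removes the averaging of `ψ`.
  have h3 : ∀ ξ : Metric.sphere (0 : EuclideanSpace ℝ (Fin d)) 1,
      ∫ x, (f ⟪(ξ : EuclideanSpace ℝ (Fin d)), x⟫ : ℂ) * Φ x = ∫ t, (f t : ℂ) * ψ t := by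
    intro ξ
    rw [← integral_mul_averageOne (fun t => by rw [hfe]) hi]
    exact integral_ridge_mul_fourier_rotateAvg hfc hfcb ψ (by simp)
  simp only [h3]
  simp

end Slicing
end

theorem mainTheorem2 (d : ℕ) (hd : 3 ≤ d) (F : ℝ → ℝ)
    (hF : ContDiffOn ℝ ((d / 2 : ℕ) : ℕ∞ω) F (Ici 0))
    (hFslow : Slicing.SlowlyIncreasing (iteratedDerivWithin (d / 2) F (Ici 0))) :
    ∃ T : 𝓢'(EuclideanSpace ℝ (Fin d), ℂ),
      Slicing.IsGeneratedBy T (Slicing.rotation fun r : ℝ => (F r : ℂ)) ∧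
      ∃ f : ℝ → ℝ, Continuous f ∧
        Slicing.IsGeneratedBy
          (𝓕⁻ (Slicing.rotationStar (EuclideanSpace ℝ (Fin d)) (𝓕 T)))
          (fun t : ℝ => (f t : ℂ)) ∧
        ∀ z : EuclideanSpace ℝ (Fin d),
          F ‖z‖ = ∫ ξ, f |⟪z, (ξ : EuclideanSpace ℝ (Fin d))⟫| ∂(Slicing.uniformSphere d) := by
  obtain ⟨-, c, k, R, hc, hk, -, hslow⟩ := hFslow
  set m := d / 2 with hm
  set G : ℕ → ℝ → ℝ := fun k => iteratedDerivWithin k F (Ici 0) with hGdef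
  have hG : ∀ k < m, ∀ x ∈ Ici (0 : ℝ), HasDerivWithinAt (G k) (G (k + 1) x) (Ici 0) x := by
    intro k hk x hx
    have h := hF.differentiableOn_iteratedDerivWithin (m := k) (by exact_mod_cast hk)
      (uniqueDiffOn_Ici 0) x hx
    simpa only [hGdef, iteratedDerivWithin_succ] using h.hasDerivWithinAt
  have hGc : ∀ k ≤ m, ContinuousOn (G k) (Ici 0) := fun k hk =>
    hF.continuousOn_iteratedDerivWithin (by exact_mod_cast hk) (uniqueDiffOn_Ici 0)
  have hG0 : G 0 = F := iteratedDerivWithin_zero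
  obtain ⟨C₀, N₀, hC₀, hm₀⟩ := Slicing.exists_growth_bound_of_continuousOn (hGc m le_rfl)
    (by linarith) (by linarith) hslow
  obtain ⟨C, N, hC, hb⟩ := Slicing.exists_growth_bound hG hC₀ hm₀
  obtain ⟨ν, a, _, hν, hmom⟩ :=
    Slicing.exists_measure_coeff_mul_moment_eq_one (d := d) (by omega)
  have hK := Slicing.abs_eulerOp_le (a := a) hb
  have hKc := Slicing.continuous_eulerOp (a := a) hGc
  have hKe : ∀ x, Slicing.eulerOp a m G (-x) = Slicing.eulerOp a m G x := fun x => by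
    simp [Slicing.eulerOp]
  have hA : 0 ≤ (∑ k ∈ Finset.range (m + 1), |a k|) * C :=
    mul_nonneg (Finset.sum_nonneg fun _ _ => abs_nonneg _) hC
  have hslice : ∀ z : EuclideanSpace ℝ (Fin d), F ‖z‖ =
      ∫ ξ, Slicing.scaleAvg ν (Slicing.eulerOp a m G) |⟪z, (ξ : EuclideanSpace ℝ (Fin d))⟫|
        ∂(Slicing.uniformSphere d) := fun z => by
    rw [Slicing.integral_scaleAvg_eulerOp_uniformSphere (by omega) hν hmom hG hGc z, hG0]
  have hfc := Slicing.continuous_scaleAvg hν hKc hA hK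
  obtain ⟨T, hT⟩ := Slicing.exists_isGeneratedBy
    (g := (Slicing.rotation fun r : ℝ => (F r : ℂ) : EuclideanSpace ℝ (Fin d) → ℂ))
    (Complex.continuous_ofReal.comp (hF.continuousOn.comp_continuous continuous_norm
      fun x => norm_nonneg x)) hC (fun x => by
        have := hb 0 (Nat.zero_le _) ‖x‖ (norm_nonneg x)
        rw [hG0] at this
        simpa [Slicing.rotation] using this)
  -- The profile `f` is the Euler operator applied to the jet of `F`, averaged over dilations by
  -- `ν`. It is even, so the absolute value in the slicing relation can be dropped for the Fourier
  -- argument.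
  refine ⟨T, hT, Slicing.scaleAvg ν (Slicing.eulerOp a m G), hfc, ?_, hslice⟩
  refine Slicing.isGeneratedBy_fourierInv_rotationStar_fourier (by omega) hfc
    (Slicing.scaleAvg_neg hKe) (mul_nonneg hA measureReal_nonneg)
    (Slicing.abs_scaleAvg_le hν hA hK) (fun z => ?_) hT
  simpa only [Slicing.scaleAvg_abs hKe] using hslice z
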